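/- Let $d\ge 1$ be an integer and let $0<p_1,p_2,p<\infty$ satisfy $\frac1{p_1}+\frac1{p_2}=1+\frac1p$. For $0<r<\infty$, $r\ne 1$, put $C_r=\big(r^{1/r}/|r'|^{1/r'}\big)^{1/2}$, where $\frac1r+\frac1{r'}=1$ (so $r'=r/(r-1)$, which is negative if $r<1$), and put $C_1=1$. Write $\|f\|_{q}=\big(\int_{\mathbb R^d}|f|^q\,dx\big)^{1/q}$ for $0<q<\infty$, and, for nonnegative measurable functions, $(f_1*f_2)(x)=\int_{\mathbb R^d}f_1(y)f_2(x-y)\,dy\in[0,\infty]$. (1) (Sharp Young inequality) If $p_1,p_2\ge 1$, then for all nonnegative $f_1\in L^{p_1}(\mathbb R^d)$ and $f_2\in L^{p_2}(\mathbb R^d)$ $$\|f_1*f_2\|_{p}\le\Big(\frac{C_{p_1}C_{p_2}}{C_p}\Big)^d\|f_1\|_{p_1}\|f_2\|_{p_2}.$$ (2) (Sharp reverse Young inequality) If $p_1,p_2\le 1$, then for all nonnegative $f_1\in L^{p_1}(\mathbb R^d)$ and $f_2\in L^{p_2}(\mathbb R^d)$ $$\|f_1*f_2\|_{p}\ge\Big(\frac{C_{p_1}C_{p_2}}{C_p}\Big)^d\|f_1\|_{p_1}\|f_2\|_{p_2},$$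 where the left-hand side may be $+\infty$. In both cases the constant is sharp: $(C_{p_1}C_{p_2}/C_p)^d$ is the smallest constant in $[0,\infty]$ for which the inequality in (1) holds for all such $f_1,f_2$, and the largest constant in $[0,\infty]$ for which the inequality in (2) holds for all such $f_1,f_2$. -/

import Mathlib

open MeasureTheory
open scoped ENNReal

/-- The constant `C_r = (r^{1/r} / |r'|^{1/r'})^{1/2}`, where `1/r + 1/r' = 1`, i.e.
`r' = r / (r - 1)` (which is negative for `0 < r < 1`).
For `r = 1` one has `r' = ∞`, and `C_1 = 1` by the usual limiting convention. -/
noncomputable def youngConst (r : ℝ) : ℝ :=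
  if r = 1 then 1
  else (r ^ (1 / r) / |r / (r - 1)| ^ (1 / (r / (r - 1)))) ^ ((1 : ℝ) / 2)

/-- The convolution `(f * g)(x) = ∫ f(y) g(x - y) dy` of two nonnegative functions on `ℝ^d`,
as a function with values in `[0, ∞]`, so that it is meaningful at every point. -/
noncomputable def nnConv {d : ℕ} (f g : EuclideanSpace ℝ (Fin d) → ℝ) :
    EuclideanSpace ℝ (Fin d) → ℝ≥0∞ :=
  fun x => ∫⁻ y, ENNReal.ofReal (f y) * ENNReal.ofReal (g (x - y))

/-! Put α = 1/p₁, β = 1/p₂, γ = 1 - 1/p, so α + β + γ = 2. By duality both inequalities reduce to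
bounds on ∫∫ f(y)^α g(z)^β h(y+z)^γ in terms of the integrals of f, g, h (`YoungBound`,
`ReverseYoungBound`).

On the line the argument is mass transport. Monotone maps u, v carry Gaussian densities to f and g,
and the powers α, β leave the factors u'^(1-α) v'^(1-β). A unimodular shear with second coordinate Y
= a + b splits the Gaussians into a factor in X and one in Y (`exists_transport_shear`). For θ =
(1-α)/γ the derivative factors equal (u'^θ v'^(1-θ))^γ, which AM-GM compares with the γ-th power of
the Y-derivative of u + v. Hölder in Y and monotone substitution then leave only Gaussian integrals.
If γ < 0, each inequality reverses, which is the reverse Young case.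

The bounds multiply over products (`YoungBound.prod`, `ReverseYoungBound.prod`), giving the d-th
power of the constant. Testing with h close to (f₁ * f₂)^p recovers the norm inequalities. Centred
Gaussians attain the constant, or approach it when some exponent is 1
(`exists_tendsto_logGaussianRatio`). -/

open ProbabilityTheory Filter Topology Set

/-! ### Monotone transport on the line -/

/-- A probability measure with strictly increasing and continuous distribution function is pushed
forward to any other probability measure on the line by a monotone map. -/
lemma exists_monotone_map_eq (γ μ : Measure ℝ) [IsProbabilityMeasure γ] [IsProbabilityMeasure μ]
    (hc : Continuous (cdf γ)) (hm : StrictMono (cdf γ)) :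
    ∃ u : ℝ → ℝ, Monotone u ∧ γ.map u = μ ∧ ∀ x σ, u x ≤ σ ↔ cdf γ x ≤ cdf μ σ := by
  have h0 : ∀ x, 0 < cdf γ x := fun x =>
    (cdf_nonneg γ (x - 1)).trans_lt (hm (by linarith))
  have h1 : ∀ x, cdf γ x < 1 := fun x =>
    (hm (show x < x + 1 by linarith)).trans_le (cdf_le_one γ (x + 1))
  -- The transport is the generalised inverse of `cdf μ` composed with `cdf γ`. Right continuity
  -- puts the infimum of `S x` in `S x`, which gives the Galois connection `gal`.
  let S : ℝ → Set ℝ := fun x => {σ | cdf γ x ≤ cdf μ σ}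
  have hSne : ∀ x, (S x).Nonempty := fun x =>
    ((tendsto_cdf_atTop μ).eventually (lt_mem_nhds (h1 x))).exists.imp fun σ h => h.le
  have hSbdd : ∀ x, BddBelow (S x) := fun x => by
    obtain ⟨m, hm⟩ := ((tendsto_cdf_atBot μ).eventually (gt_mem_nhds (h0 x))).exists
    refine ⟨m, fun σ hσ => ?_⟩
    by_contra! hlt
    exact absurd ((monotone_cdf μ) hlt.le) (not_le.2 (hm.trans_le hσ))
  have hmem : ∀ x, sInf (S x) ∈ S x := fun x => by
    have hr : Tendsto (cdf μ) (𝓝[>] (sInf (S x))) (𝓝 (cdf μ (sInf (S x)))) :=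
      ((cdf μ).right_continuous _).tendsto.mono_left (nhdsWithin_mono _ Ioi_subset_Ici_self)
    refine ge_of_tendsto hr ?_
    filter_upwards [self_mem_nhdsWithin] with y hy
    obtain ⟨σ, hσ, hlt⟩ := exists_lt_of_csInf_lt (hSne x) hy
    exact le_trans hσ (monotone_cdf μ hlt.le)
  have gal : ∀ x σ, sInf (S x) ≤ σ ↔ cdf γ x ≤ cdf μ σ := fun x σ =>
    ⟨fun h => (hmem x).trans (monotone_cdf μ h), fun h => csInf_le (hSbdd x) h⟩
  have hu : Monotone fun x => sInf (S x) := fun x y hxy =>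
    (gal x _).2 ((hm.monotone hxy).trans (hmem y))
  refine ⟨fun x => sInf (S x), hu, ?_, gal⟩
  have := Measure.isProbabilityMeasure_map (μ := γ) hu.measurable.aemeasurable
  refine Measure.ext_of_Iic _ _ fun σ => ?_
  rw [Measure.map_apply hu.measurable measurableSet_Iic]
  have hpre : (fun x => sInf (S x)) ⁻¹' Iic σ = {x | cdf γ x ≤ cdf μ σ} := by
    ext x; exact gal x σ
  rw [hpre, ← ofReal_cdf μ σ]
  rcases (cdf_nonneg μ σ).eq_or_lt with hz | hz
  · have : {x | cdf γ x ≤ cdf μ σ} = ∅ := by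
      ext x; simpa [← hz] using h0 x
    rw [this, ← hz]; simp
  rcases (cdf_le_one μ σ).eq_or_lt with ho | ho
  · have : {x | cdf γ x ≤ cdf μ σ} = univ := by
      ext x; simpa [ho] using (h1 x).le
    rw [this, ho]; simp
  obtain ⟨a, ha⟩ := ((tendsto_cdf_atBot γ).eventually (gt_mem_nhds hz)).exists
  obtain ⟨b, hb⟩ := ((tendsto_cdf_atTop γ).eventually (lt_mem_nhds ho)).exists
  obtain ⟨x₀, hx₀⟩ := mem_range_of_exists_le_of_exists_ge hc ⟨a, ha.le⟩ ⟨b, hb.le⟩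
  have : {x | cdf γ x ≤ cdf μ σ} = Iic x₀ := by
    ext x; simp [← hx₀, hm.le_iff_le]
  rw [this, ← hx₀, ofReal_cdf]

lemma continuous_cdf (μ : Measure ℝ) [IsProbabilityMeasure μ] [NullSingletonClass μ] :
    Continuous (cdf μ) := by
  refine continuous_iff_continuousAt.2 fun x => ?_
  rw [(monotone_cdf μ).continuousAt_iff_leftLim_eq_rightLim, StieltjesFunction.rightLim_eq]
  have h : (cdf μ).measure {x} = 0 := by rw [measure_cdf]; simp
  rw [StieltjesFunction.measure_singleton, ENNReal.ofReal_eq_zero] at h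
  exact le_antisymm ((monotone_cdf μ).leftLim_le le_rfl) (by linarith)

lemma ae_hasDerivAt_cdf_withDensity {f : ℝ → ℝ≥0∞} (hf : Measurable f)
    [IsProbabilityMeasure (volume.withDensity f)] :
    ∀ᵐ x, HasDerivAt (cdf (volume.withDensity f)) (f x).toReal x := by
  filter_upwards [(cdf (volume.withDensity f)).ae_hasDerivAt,
    Measure.rnDeriv_withDensity volume hf] with x hx h2
  rwa [measure_cdf, h2] at hx

/-- The monotone transport between two probability densities on the line, the first of which is
positive, together with its Monge--Ampère equation. -/
lemma exists_monotone_transport {F f : ℝ → ℝ≥0∞} (hF : Measurable F) (hf : Measurable f)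
    (hF0 : ∀ x, 0 < F x) (hF1 : ∫⁻ x, F x = 1) (hf1 : ∫⁻ x, f x = 1) :
    ∃ u : ℝ → ℝ, Monotone u ∧ (volume.withDensity F).map u = volume.withDensity f ∧
      ∀ᵐ x, DifferentiableAt ℝ u x ∧ 0 < deriv u x ∧ f (u x) ≠ ∞ ∧ F x ≠ ∞ ∧
        f (u x) * ENNReal.ofReal (deriv u x) = F x := by
  have hγ : IsProbabilityMeasure (volume.withDensity F) := ⟨by simp [hF1]⟩
  have hμ : IsProbabilityMeasure (volume.withDensity f) := ⟨by simp [hf1]⟩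
  set γ := volume.withDensity F with hγdef
  set μ := volume.withDensity f with hμdef
  have hmono : StrictMono (cdf γ) := by
    intro a b hab
    have h : 0 < γ (Ioc a b) := by
      rw [hγdef, withDensity_apply _ measurableSet_Ioc, setLIntegral_pos_iff hF]
      have : Function.support F = univ := by ext x; simpa using (hF0 x).ne'
      simp [this, hab]
    rw [← measure_cdf γ, StieltjesFunction.measure_Ioc] at h
    linarith [ENNReal.ofReal_pos.1 h]
  obtain ⟨u, hu, hmap, gal⟩ := exists_monotone_map_eq γ μ (continuous_cdf γ) hmono
  refine ⟨u, hu, hmap, ?_⟩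
  -- By `gal`, `cdf μ` is at most `cdf γ x` to the left of `u x`; having a density, μ has no atoms,
  -- so this passes to the limit.
  have hcomp : ∀ x, cdf μ (u x) = cdf γ x := by
    intro x
    refine le_antisymm ?_ ((gal x _).1 le_rfl)
    refine le_of_tendsto (((continuous_cdf μ).tendsto (u x)).mono_left
      (nhdsWithin_le_nhds (s := Iio (u x)))) ?_
    filter_upwards [self_mem_nhdsWithin] with σ hσ
    by_contra! hlt
    exact absurd ((gal x σ).2 hlt.le) (not_le.2 hσ)
  have hfin : ∀ᵐ x, f x ≠ ∞ := by
    filter_upwards [ae_lt_top hf (by simp [hf1])] with x hx using hx.ne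
  have hFfin : ∀ᵐ x, F x ≠ ∞ := by
    filter_upwards [ae_lt_top hF (by simp [hF1])] with x hx using hx.ne
  -- Statements true μ-a.e. pull back along `u` to γ-a.e.; as F > 0, this means Lebesgue-a.e.
  have hpull : ∀ᵐ x, HasDerivAt (cdf μ) (f (u x)).toReal (u x) ∧ f (u x) ≠ ∞ := by
    have h1 : ∀ᵐ y ∂μ, HasDerivAt (cdf μ) (f y).toReal y ∧ f y ≠ ∞ :=
      (withDensity_absolutelyContinuous volume f).ae_le
        ((ae_hasDerivAt_cdf_withDensity hf).and hfin)
    have h2 := ae_of_ae_map (μ := γ) hu.measurable.aemeasurable (hmap.symm ▸ h1 :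
      ∀ᵐ y ∂γ.map u, HasDerivAt (cdf μ) (f y).toReal y ∧ f y ≠ ∞)
    refine (ae_withDensity_iff hF).1 h2 |>.mono fun x hx => hx (hF0 x).ne'
  filter_upwards [hpull, hu.ae_differentiableAt, ae_hasDerivAt_cdf_withDensity hF, hFfin]
    with x ⟨h1, h1'⟩ h2 h3 h4
  have hchain := h1.comp x h2.hasDerivAt
  have heq : (f (u x)).toReal * deriv u x = (F x).toReal := by
    refine hchain.unique ?_
    have : (cdf μ : ℝ → ℝ) ∘ u = cdf γ := funext hcomp
    rw [this]; exact h3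
  have hd : 0 < deriv u x := by
    have hpos : 0 < (F x).toReal := ENNReal.toReal_pos (hF0 x).ne' h4
    rw [← heq] at hpos
    exact (pos_iff_pos_of_mul_pos hpos).1 (lt_of_le_of_ne ENNReal.toReal_nonneg
      (fun h => by simp [← h] at hpos))
  refine ⟨h2, hd, h1', h4, ?_⟩
  rw [← ENNReal.ofReal_toReal h1', ← ENNReal.ofReal_mul ENNReal.toReal_nonneg, heq,
    ENNReal.ofReal_toReal h4]

/-- Write f^α k = f · (f^(α-1) k), transport the measure f dx, and eliminate f ∘ u with f(u) u' = F.
A single `u` serves every `k`, so the identity can be used inside an iterated integral. -/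
lemma exists_monotone_lintegral_rpow_eq {F f : ℝ → ℝ≥0∞} (hF : Measurable F) (hf : Measurable f)
    (hF0 : ∀ x, 0 < F x) (hF1 : ∫⁻ x, F x = 1) (hf1 : ∫⁻ x, f x = 1) {α : ℝ} (hα : 0 < α) :
    ∃ u : ℝ → ℝ, Monotone u ∧ (∀ᵐ x, DifferentiableAt ℝ u x ∧ 0 < deriv u x) ∧
      ∀ k : ℝ → ℝ≥0∞, Measurable k → ∫⁻ x, f x ^ α * k x =
        ∫⁻ x, F x ^ α * ENNReal.ofReal (deriv u x) ^ (1 - α) * k (u x) := by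
  obtain ⟨u, hu, hmap, hae⟩ := exists_monotone_transport hF hf hF0 hF1 hf1
  refine ⟨u, hu, hae.mono fun x hx => ⟨hx.1, hx.2.1⟩, fun k hk => ?_⟩
  have hm : Measurable fun x => f x ^ (α - 1) * k x := (hf.pow_const _).mul hk
  calc ∫⁻ x, f x ^ α * k x = ∫⁻ x, f x * (f x ^ (α - 1) * k x) := by
        refine lintegral_congr_ae ?_
        filter_upwards [ae_lt_top hf (by simp [hf1])] with x hx
        rcases eq_or_ne (f x) 0 with h0 | h0
        · simp [h0, hα]
        · rw [← mul_assoc]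
          congr 1
          nth_rw 2 [← ENNReal.rpow_one (f x)]
          rw [← ENNReal.rpow_add _ _ h0 hx.ne]
          ring_nf
    _ = ∫⁻ x, f x ^ (α - 1) * k x ∂(volume.withDensity f) := by
        rw [lintegral_withDensity_eq_lintegral_mul _ hf hm]; rfl
    _ = ∫⁻ x, f (u x) ^ (α - 1) * k (u x) ∂(volume.withDensity F) := by
        rw [← hmap, lintegral_map hm hu.measurable]
    _ = ∫⁻ x, F x * (f (u x) ^ (α - 1) * k (u x)) := by
        exact lintegral_withDensity_eq_lintegral_mul _ hF (hm.comp hu.measurable)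
    _ = _ := by
        refine lintegral_congr_ae ?_
        filter_upwards [hae] with x ⟨_, hd, hfin, hFfin, heq⟩
        rw [← mul_assoc]
        congr 1
        have hD : ENNReal.ofReal (deriv u x) ≠ 0 := by simpa using hd
        have hf0 : f (u x) ≠ 0 := by
          intro h; rw [h, zero_mul] at heq; exact (hF0 x).ne heq
        rw [← heq, ENNReal.mul_rpow_of_ne_zero hf0 hD, mul_assoc (f (u x) ^ α),
          ← ENNReal.rpow_add _ _ hD ENNReal.ofReal_ne_top, mul_right_comm]
        have e1 : f (u x) * f (u x) ^ (α - 1) = f (u x) ^ α := by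
          nth_rw 1 [← ENNReal.rpow_one (f (u x))]
          rw [← ENNReal.rpow_add _ _ hf0 hfin]
          ring_nf
        rw [e1]
        simp

/-! ### Substitution, reverse Hölder, shear and Gaussian integrals -/

/-- The area formula on the set of differentiability. Jumps of `y` may leave gaps in the image,
hence only an inequality. -/
lemma lintegral_deriv_mul_comp_le_of_monotone {y : ℝ → ℝ} (hy : Monotone y) (h : ℝ → ℝ≥0∞) :
    ∫⁻ x, ENNReal.ofReal (deriv y x) * h (y x) ≤ ∫⁻ x, h x := by
  have hS : MeasurableSet {x | DifferentiableAt ℝ y x} := measurableSet_of_differentiableAt ℝ y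
  have hae : (volume : Measure ℝ).restrict {x | DifferentiableAt ℝ y x} = volume :=
    Measure.restrict_eq_self_of_ae_mem hy.ae_differentiableAt
  calc ∫⁻ x, ENNReal.ofReal (deriv y x) * h (y x)
      = ∫⁻ x in {x | DifferentiableAt ℝ y x}, ENNReal.ofReal (deriv y x) * h (y x) := by rw [hae]
    _ = ∫⁻ x in y '' {x | DifferentiableAt ℝ y x}, h x :=
        (lintegral_image_eq_lintegral_deriv_mul_of_monotoneOn hS
          (fun x hx => hx.hasDerivAt.hasDerivWithinAt) (hy.monotoneOn _) h).symm
    _ ≤ ∫⁻ x, h x := setLIntegral_le_lintegral _ _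

/-- The reverse Hölder inequality, with one nonpositive exponent. -/
lemma le_lintegral_mul_rpow_of_nonpos {X : Type*} [MeasurableSpace X] {μ : Measure X}
    {a b : X → ℝ≥0∞} (ha : AEMeasurable a μ) (hb : AEMeasurable b μ) (hb0 : ∀ᵐ x ∂μ, b x ≠ 0)
    {p q : ℝ} (hq : q ≤ 0) (hpq : p + q = 1) :
    (∫⁻ x, a x ∂μ) ^ p * (∫⁻ x, b x ∂μ) ^ q ≤ ∫⁻ x, a x ^ p * b x ^ q ∂μ := by
  have hp : 0 < p := by linarith
  rcases hq.eq_or_lt with rfl | hq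
  · obtain rfl : p = 1 := by linarith
    simp
  rcases eq_or_ne (∫⁻ x, b x ∂μ) ∞ with htop | htop
  · simp [htop, ENNReal.top_rpow_of_neg hq]
  rcases eq_or_ne (∫⁻ x, b x ∂μ) 0 with hz | hz
  · have : μ = 0 := by
      rw [lintegral_eq_zero_iff' hb] at hz
      have h : ∀ᵐ x ∂μ, False := by
        filter_upwards [hz, hb0] with x h1 h2 using h2 h1
      rwa [Filter.eventually_false_iff_eq_bot, ae_eq_bot] at h
    simp [this, hp]
  have hfin : ∀ᵐ x ∂μ, b x < ∞ := ae_lt_top' hb htop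
  -- Ordinary Hölder for a = (a^p b^q)^(1/p) · b^(-q/p), whose weights 1/p and -q/p are nonnegative
  -- and sum to 1.
  have key : ∫⁻ x, a x ∂μ ≤
      (∫⁻ x, a x ^ p * b x ^ q ∂μ) ^ (1 / p) * (∫⁻ x, b x ∂μ) ^ (-q / p) := by
    refine le_trans (le_of_eq ?_) (ENNReal.lintegral_mul_norm_pow_le
      ((ha.pow_const p).mul (hb.pow_const q)) hb (by positivity)
      (div_nonneg (by linarith) hp.le) (by field_simp; linarith))
    refine lintegral_congr_ae ?_
    filter_upwards [hb0, hfin] with x h0 hlt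
    rw [Pi.mul_apply, ENNReal.mul_rpow_of_nonneg _ _ (by positivity), ← ENNReal.rpow_mul,
      ← ENNReal.rpow_mul, mul_assoc, ← ENNReal.rpow_add _ _ h0 hlt.ne]
    rw [show p * (1 / p) = 1 by field_simp, show q * (1 / p) + -q / p = 0 by ring]
    simp
  calc (∫⁻ x, a x ∂μ) ^ p * (∫⁻ x, b x ∂μ) ^ q
      ≤ ((∫⁻ x, a x ^ p * b x ^ q ∂μ) ^ (1 / p) * (∫⁻ x, b x ∂μ) ^ (-q / p)) ^ p
          * (∫⁻ x, b x ∂μ) ^ q := by gcongr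
    _ = ∫⁻ x, a x ^ p * b x ^ q ∂μ := by
        rw [ENNReal.mul_rpow_of_nonneg _ _ hp.le, ← ENNReal.rpow_mul, ← ENNReal.rpow_mul, mul_assoc,
          ← ENNReal.rpow_add _ _ hz htop]
        rw [show 1 / p * p = 1 by field_simp, show -q / p * p + q = 0 by field_simp; ring]
        simp

/-- Two translations with Tonelli in between: first b = Y - a for fixed a, then a = X + θY for fixed
Y. No Jacobian appears, and Y = a + b. -/
lemma lintegral_lintegral_shear {Φ : ℝ → ℝ → ℝ≥0∞} (hΦ : Measurable (Function.uncurry Φ)) (θ : ℝ) :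
    ∫⁻ a, ∫⁻ b, Φ a b = ∫⁻ X, ∫⁻ Y, Φ (X + θ * Y) (Y - (X + θ * Y)) := by
  have h1 : ∀ a, ∫⁻ b, Φ a b = ∫⁻ Y, Φ a (Y - a) := fun a =>
    (lintegral_sub_right_eq_self (fun b => Φ a b) a).symm
  have h2 : ∀ Y, ∫⁻ a, Φ a (Y - a) = ∫⁻ X, Φ (X + θ * Y) (Y - (X + θ * Y)) := fun Y =>
    (lintegral_add_right_eq_self (fun a => Φ a (Y - a)) (θ * Y)).symm
  simp_rw [h1]
  rw [lintegral_lintegral_swap]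
  · simp_rw [h2]
    rw [lintegral_lintegral_swap]
    exact (hΦ.comp (show Measurable fun z : ℝ × ℝ => (z.2 + θ * z.1, z.1 - (z.2 + θ * z.1)) by
      fun_prop)).aemeasurable
  · exact (hΦ.comp (show Measurable fun z : ℝ × ℝ => (z.1, z.2 - z.1) by fun_prop)).aemeasurable

lemma lintegral_exp_neg_sq_div {b : ℝ} (hb : 0 < b) :
    ∫⁻ x : ℝ, ENNReal.ofReal (Real.exp (-(x ^ 2 / b))) =
      ENNReal.ofReal ((Real.pi * b) ^ (1 / 2 : ℝ)) := by
  have e : ∀ x : ℝ, -(x ^ 2 / b) = -(1 / b) * x ^ 2 := fun x => by ring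
  simp_rw [e]
  rw [← ofReal_integral_eq_lintegral_ofReal (integrable_exp_neg_mul_sq (by positivity))
    (ae_of_all _ fun x => (Real.exp_pos _).le), integral_gaussian, Real.sqrt_eq_rpow]
  congr 2
  field_simp

lemma ae_comp_affine {P : ℝ → Prop} (hP : ∀ᵐ x, P x) {a : ℝ} (ha : a ≠ 0) (b : ℝ) :
    ∀ᵐ x, P (a * x + b) := by
  have h1 : ∀ᵐ x, P (x + b) :=
    (measurePreserving_add_right volume b).quasiMeasurePreserving.ae hP
  have h2 : Measure.QuasiMeasurePreserving (fun x : ℝ => a * x) volume volume :=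
    ⟨by fun_prop, by
      rw [Real.map_volume_mul_left ha]; exact Measure.smul_absolutelyContinuous⟩
  exact h2.ae h1

/-- Transport of two probability densities to centred Gaussian densities, followed by a linear
change of variables that separates the Gaussian factors. -/
lemma exists_transport_shear {f g : ℝ → ℝ≥0∞} (hf : Measurable f) (hg : Measurable g)
    (hf1 : ∫⁻ x, f x = 1) (hg1 : ∫⁻ x, g x = 1) {α β θ : ℝ} (hα : 0 < α) (hβ : 0 < β)
    (hθ : 0 < θ) (hθ1 : θ < 1) :
    ∃ (y : ℝ → ℝ → ℝ) (D : ℝ → ℝ → ℝ≥0∞), (∀ X, Monotone (y X)) ∧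
      Measurable (Function.uncurry y) ∧ Measurable (Function.uncurry D) ∧
      (∀ X, ∀ᵐ Y, ∃ s t : ℝ, 0 < s ∧ 0 < t ∧ deriv (y X) Y = θ * s + (1 - θ) * t ∧
        D X Y = ENNReal.ofReal (s ^ (1 - α) * t ^ (1 - β))) ∧
      ∀ k : ℝ → ℝ≥0∞, Measurable k → ∫⁻ a, ∫⁻ b, f a ^ α * (g b ^ β * k (a + b)) =
        ENNReal.ofReal ((Real.pi * (θ * α)) ^ (-(α / 2)) *
          (Real.pi * ((1 - θ) * β)) ^ (-(β / 2))) *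
        ∫⁻ X, ENNReal.ofReal (Real.exp (-(X ^ 2 / (θ * (1 - θ))))) *
          ∫⁻ Y, ENNReal.ofReal (Real.exp (-Y ^ 2)) * (D X Y * k (y X Y)) := by
  have hθ' : 0 < 1 - θ := by linarith
  have hdens : ∀ b : ℝ, 0 < b → ∫⁻ x, ENNReal.ofReal
      ((Real.pi * b) ^ (-(1 / 2) : ℝ) * Real.exp (-(x ^ 2 / b))) = 1 := fun b hb => by
    have hpb : 0 < Real.pi * b := by positivity
    simp_rw [ENNReal.ofReal_mul (Real.rpow_nonneg hpb.le (-(1 / 2)))]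
    rw [lintegral_const_mul _ (by fun_prop), lintegral_exp_neg_sq_div hb,
      ← ENNReal.ofReal_mul (by positivity), ← Real.rpow_add hpb]
    simp
  -- The rates are chosen so that the α-th and β-th powers of the two densities are proportional to
  -- exp(-a²/θ) and exp(-b²/(1-θ)).
  obtain ⟨u, hu, huae, huk⟩ := exists_monotone_lintegral_rpow_eq
    (F := fun x => ENNReal.ofReal ((Real.pi * (θ * α)) ^ (-(1 / 2) : ℝ) *
      Real.exp (-(x ^ 2 / (θ * α))))) (by fun_prop) hf
    (fun x => ENNReal.ofReal_pos.2 (by positivity)) (hdens _ (by positivity)) hf1 hα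
  obtain ⟨v, hv, hvae, hvk⟩ := exists_monotone_lintegral_rpow_eq
    (F := fun x => ENNReal.ofReal ((Real.pi * ((1 - θ) * β)) ^ (-(1 / 2) : ℝ) *
      Real.exp (-(x ^ 2 / ((1 - θ) * β))))) (by fun_prop) hg
    (fun x => ENNReal.ofReal_pos.2 (by positivity)) (hdens _ (by positivity)) hg1 hβ
  have hum := hu.measurable
  have hvm := hv.measurable
  have hdu := measurable_deriv u
  have hdv := measurable_deriv v
  refine ⟨fun X Y => u (X + θ * Y) + v (Y - (X + θ * Y)),
    fun X Y => ENNReal.ofReal (deriv u (X + θ * Y)) ^ (1 - α) *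
      ENNReal.ofReal (deriv v (Y - (X + θ * Y))) ^ (1 - β), ?_, ?_, ?_, ?_, ?_⟩
  · intro X Y Y' hY
    exact add_le_add (hu (by nlinarith)) (hv (by nlinarith))
  · simp only [Function.uncurry_def]; fun_prop
  · simp only [Function.uncurry_def]; fun_prop
  · intro X
    filter_upwards [ae_comp_affine huae hθ.ne' X, ae_comp_affine hvae hθ'.ne' (-X)] with Y h1 h2
    have e1 : θ * Y + X = X + θ * Y := by ring
    have e2 : (1 - θ) * Y + -X = Y - (X + θ * Y) := by ring
    rw [e1] at h1
    rw [e2] at h2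
    refine ⟨deriv u (X + θ * Y), deriv v (Y - (X + θ * Y)), h1.2, h2.2, ?_, ?_⟩
    · have a1 : HasDerivAt (fun Y => X + θ * Y) θ Y := by
        simpa using ((hasDerivAt_id Y).const_mul θ).const_add X
      have a2 : HasDerivAt (fun Y => Y - (X + θ * Y)) (1 - θ) Y := (hasDerivAt_id Y).sub a1
      have b1 := h1.1.hasDerivAt.comp Y a1
      have b2 := h2.1.hasDerivAt.comp Y a2
      have := (b1.add b2).deriv
      rw [mul_comm θ, mul_comm (1 - θ)]
      exact this
    · rw [ENNReal.ofReal_rpow_of_pos h1.2, ENNReal.ofReal_rpow_of_pos h2.2,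
        ← ENNReal.ofReal_mul (Real.rpow_nonneg h1.2.le _)]
  · intro k hk
    have s1 : ∀ a, ∫⁻ b, f a ^ α * (g b ^ β * k (a + b)) =
        f a ^ α * ∫⁻ b, g b ^ β * k (a + b) := fun a =>
      lintegral_const_mul _ (by fun_prop)
    simp_rw [s1]
    rw [huk _ (Measurable.lintegral_prod_right' (f := fun z : ℝ × ℝ => g z.2 ^ β * k (z.1 + z.2))
      (by fun_prop))]
    have s2 : ∀ a, ∫⁻ b, g b ^ β * k (u a + b) = _ := fun a => hvk (fun b => k (u a + b))
      (by fun_prop)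
    simp_rw [s2]
    have s3 : ∀ (c : ℝ → ℝ≥0∞) (m : ℝ → ℝ → ℝ≥0∞), (∀ a, Measurable (m a)) →
        ∫⁻ a, c a * ∫⁻ b, m a b = ∫⁻ a, ∫⁻ b, c a * m a b := fun c m hm =>
      lintegral_congr fun a => (lintegral_const_mul _ (hm a)).symm
    rw [s3 _ _ (fun a => by fun_prop), lintegral_lintegral_shear (by
      simp only [Function.uncurry_def]; fun_prop) θ]
    rw [← lintegral_const_mul' _ _ ENNReal.ofReal_ne_top]
    refine lintegral_congr fun X => ?_
    rw [← lintegral_const_mul' _ _ ENNReal.ofReal_ne_top,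
      ← lintegral_const_mul' _ _ ENNReal.ofReal_ne_top]
    refine lintegral_congr fun Y => ?_
    -- The cross terms cancel: (X+θY)²/θ + ((1-θ)Y-X)²/(1-θ) = X²/(θ(1-θ)) + Y².
    have hgauss : ENNReal.ofReal ((Real.pi * (θ * α)) ^ (-(1 / 2) : ℝ) *
          Real.exp (-((X + θ * Y) ^ 2 / (θ * α)))) ^ α *
        ENNReal.ofReal ((Real.pi * ((1 - θ) * β)) ^ (-(1 / 2) : ℝ) *
          Real.exp (-((Y - (X + θ * Y)) ^ 2 / ((1 - θ) * β)))) ^ β =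
        ENNReal.ofReal ((Real.pi * (θ * α)) ^ (-(α / 2)) *
          (Real.pi * ((1 - θ) * β)) ^ (-(β / 2))) *
        (ENNReal.ofReal (Real.exp (-(X ^ 2 / (θ * (1 - θ))))) *
          ENNReal.ofReal (Real.exp (-Y ^ 2))) := by
      rw [ENNReal.ofReal_rpow_of_pos (by positivity), ENNReal.ofReal_rpow_of_pos (by positivity),
        ← ENNReal.ofReal_mul (by positivity), ← ENNReal.ofReal_mul (by positivity),
        ← ENNReal.ofReal_mul (by positivity)]
      congr 1
      have hpow : ∀ A t e : ℝ, 0 < A →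
          (A ^ (-(1 / 2) : ℝ) * Real.exp t) ^ e = A ^ (-(e / 2)) * Real.exp (t * e) := by
        intro A t e hA
        rw [Real.mul_rpow (by positivity) (by positivity), ← Real.rpow_mul hA.le, ← Real.exp_mul]
        ring_nf
      rw [hpow _ _ _ (by positivity), hpow _ _ _ (by positivity), mul_mul_mul_comm,
        ← Real.exp_add, ← Real.exp_add]
      congr 2
      field_simp; ring
    have harr : ∀ A B C D E : ℝ≥0∞, A * B * (C * D * E) = (A * C) * (B * D * E) := by
      intros; ring
    rw [harr, hgauss]
    ring

/-! ### Trilinear inequalities on the line -/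

/-- The trilinear form of Young's convolution inequality, with exponents `α`, `β`, `γ` and
constant `K`. -/
def YoungBound (E : Type*) [MeasureSpace E] [Add E] (α β γ : ℝ) (K : ℝ≥0∞) : Prop :=
  ∀ f g h : E → ℝ≥0∞, Measurable f → Measurable g → Measurable h →
    ∫⁻ y, f y ≠ ∞ → ∫⁻ z, g z ≠ ∞ →
    ∫⁻ y, ∫⁻ z, f y ^ α * (g z ^ β * h (y + z) ^ γ) ≤
      K * ((∫⁻ y, f y) ^ α * ((∫⁻ z, g z) ^ β * (∫⁻ x, h x) ^ γ))

/-- The trilinear form of the reverse Young inequality, with exponents `α`, `β`, `γ` and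
constant `K`. -/
def ReverseYoungBound (E : Type*) [MeasureSpace E] [Add E] (α β γ : ℝ) (K : ℝ≥0∞) : Prop :=
  ∀ f g h : E → ℝ≥0∞, Measurable f → Measurable g → Measurable h →
    ∫⁻ y, f y ≠ ∞ → ∫⁻ z, g z ≠ ∞ → (∀ x, h x ≠ 0) →
    K * ((∫⁻ y, f y) ^ α * ((∫⁻ z, g z) ^ β * (∫⁻ x, h x) ^ γ)) ≤
      ∫⁻ y, ∫⁻ z, f y ^ α * (g z ^ β * h (y + z) ^ γ)

/-- The sharp constant of the trilinear Young inequality on the line, as produced by the transport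
argument. -/
noncomputable def trilinearConst (α β γ : ℝ) : ℝ :=
  ((Real.pi * ((1 - α) / γ * α)) ^ (-(α / 2)) *
    (Real.pi * ((1 - (1 - α) / γ) * β)) ^ (-(β / 2))) *
  ((Real.pi * ((1 - α) / γ * (1 - (1 - α) / γ))) ^ (1 / 2 : ℝ) *
    ((Real.pi * (1 - γ)) ^ (1 / 2 : ℝ)) ^ (1 - γ))

lemma ofReal_exp_neg_sq_eq_rpow {c : ℝ} (hc : 0 < c) (Y : ℝ) :
    ENNReal.ofReal (Real.exp (-Y ^ 2)) = ENNReal.ofReal (Real.exp (-(Y ^ 2 / c))) ^ c := by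
  rw [ENNReal.ofReal_rpow_of_pos (Real.exp_pos _), ← Real.exp_mul]
  congr 2
  field_simp

lemma ENNReal.rpow_le_rpow_of_nonpos {a b : ℝ≥0∞} {z : ℝ} (hz : z ≤ 0) (h : a ≤ b) :
    b ^ z ≤ a ^ z := by
  rw [← neg_neg z, ENNReal.rpow_neg, ENNReal.rpow_neg a]
  exact ENNReal.inv_le_inv.2 (ENNReal.rpow_le_rpow h (by linarith))

lemma rpow_mul_rpow_eq_geom_mean {s t θ α β γ : ℝ} (hs : 0 < s) (ht : 0 < t)
    (hα : 1 - α = θ * γ) (hβ : 1 - β = (1 - θ) * γ) :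
    s ^ (1 - α) * t ^ (1 - β) = (s ^ θ * t ^ (1 - θ)) ^ γ := by
  rw [Real.mul_rpow (by positivity) (by positivity), ← Real.rpow_mul hs.le, ← Real.rpow_mul ht.le,
    hα, hβ]

lemma geom_mean_le_arith_mean_pair {s t θ : ℝ} (hs : 0 < s) (ht : 0 < t) (hθ : 0 < θ)
    (hθ1 : θ < 1) : s ^ θ * t ^ (1 - θ) ≤ θ * s + (1 - θ) * t :=
  Real.geom_mean_le_arith_mean2_weighted hθ.le (by linarith) hs.le ht.le (by ring)

lemma lintegral_gaussian_mul_const {θ : ℝ} (hθ : 0 < θ) (hθ1 : θ < 1) {c : ℝ} (hc : 0 < c)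
    {A : ℝ} (hA : 0 ≤ A) (H : ℝ≥0∞) :
    ENNReal.ofReal A * ∫⁻ X : ℝ, ENNReal.ofReal (Real.exp (-(X ^ 2 / (θ * (1 - θ))))) *
      ((∫⁻ Y : ℝ, ENNReal.ofReal (Real.exp (-(Y ^ 2 / c)))) ^ c * H) =
    ENNReal.ofReal (A * ((Real.pi * (θ * (1 - θ))) ^ (1 / 2 : ℝ) *
      ((Real.pi * c) ^ (1 / 2 : ℝ)) ^ c)) * H := by
  have : 0 < 1 - θ := by linarith
  have hpos : 0 < (Real.pi * c) ^ (1 / 2 : ℝ) := by positivity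
  rw [lintegral_mul_const _ (by fun_prop), lintegral_exp_neg_sq_div (by positivity),
    lintegral_exp_neg_sq_div hc, ENNReal.ofReal_mul hA, ENNReal.ofReal_mul (by positivity),
    ENNReal.ofReal_rpow_of_pos hpos]
  ring

/-- Since 1-α = θγ and 1-β = (1-θ)γ, AM-GM bounds the derivative factor by the γ-th power of the
derivative of `y X`. Hölder with weights 1-γ and γ then bounds the Y-integral uniformly in X. -/
lemma youngBound_real_aux {α β γ : ℝ} (hα : 0 < α) (hα1 : α < 1) (hβ : 0 < β) (hβ1 : β < 1)
    (hγ : 0 < γ) (hγ1 : γ < 1) (hsum : α + β + γ = 2) {f g h : ℝ → ℝ≥0∞} (hf : Measurable f)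
    (hg : Measurable g) (hh : Measurable h) (hf1 : ∫⁻ x, f x = 1) (hg1 : ∫⁻ x, g x = 1) :
    ∫⁻ y, ∫⁻ z, f y ^ α * (g z ^ β * h (y + z) ^ γ) ≤
      ENNReal.ofReal (trilinearConst α β γ) * (∫⁻ x, h x) ^ γ := by
  set θ := (1 - α) / γ with hθdef
  have hθ : 0 < θ := div_pos (by linarith) hγ
  have hθ1 : θ < 1 := by rw [hθdef, div_lt_one hγ]; linarith
  have hθ' : 0 < 1 - θ := by linarith
  have eα : 1 - α = θ * γ := by rw [hθdef, div_mul_cancel₀ _ hγ.ne']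
  have eβ : 1 - β = (1 - θ) * γ := by linarith
  obtain ⟨y, D, hy, hym, hDm, hD, key⟩ := exists_transport_shear hf hg hf1 hg1 hα hβ hθ hθ1
  rw [key (fun x => h x ^ γ) (by fun_prop)]
  have inner : ∀ X, ∫⁻ Y, ENNReal.ofReal (Real.exp (-Y ^ 2)) * (D X Y * h (y X Y) ^ γ) ≤
      (∫⁻ Y : ℝ, ENNReal.ofReal (Real.exp (-(Y ^ 2 / (1 - γ))))) ^ (1 - γ) *
        (∫⁻ x, h x) ^ γ := by
    intro X
    have hyX := (hy X).measurable
    have hdX := measurable_deriv (y X)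
    calc _ ≤ ∫⁻ Y, ENNReal.ofReal (Real.exp (-(Y ^ 2 / (1 - γ)))) ^ (1 - γ) *
          (ENNReal.ofReal (deriv (y X) Y) * h (y X Y)) ^ γ := by
          refine lintegral_mono_ae ?_
          filter_upwards [hD X] with Y ⟨s, t, hs, ht, hd, hDe⟩
          rw [ofReal_exp_neg_sq_eq_rpow (by linarith : 0 < 1 - γ),
            ENNReal.mul_rpow_of_nonneg _ _ hγ.le, hDe, hd, rpow_mul_rpow_eq_geom_mean hs ht eα eβ,
            ENNReal.ofReal_rpow_of_pos (by positivity : 0 < θ * s + (1 - θ) * t)]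
          refine mul_le_mul_right (mul_le_mul_left (ENNReal.ofReal_le_ofReal ?_) _) _
          exact Real.rpow_le_rpow (by positivity)
            (geom_mean_le_arith_mean_pair hs ht hθ hθ1) hγ.le
      _ ≤ _ := by
          refine (ENNReal.lintegral_mul_norm_pow_le (by fun_prop) (by fun_prop) (by linarith)
            hγ.le (by ring)).trans ?_
          exact mul_le_mul_right (ENNReal.rpow_le_rpow
            (lintegral_deriv_mul_comp_le_of_monotone (hy X) h) hγ.le) _
  calc _ ≤ _ := mul_le_mul_right (lintegral_mono fun X => mul_le_mul_right (inner X) _) _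
    _ = _ := by
      rw [lintegral_gaussian_mul_const hθ hθ1 (by linarith) (by positivity), trilinearConst]

/-- The same three steps, each reversed by the negative power γ. Nonvanishing of `h` is what allows
γ-th powers of products to be split and reverse Hölder to be applied in [0, ∞]. -/
lemma reverseYoungBound_real_aux {α β γ : ℝ} (hα1 : 1 < α) (hβ1 : 1 < β)
    (hγ : γ < 0) (hsum : α + β + γ = 2) {f g h : ℝ → ℝ≥0∞} (hf : Measurable f)
    (hg : Measurable g) (hh : Measurable h) (hf1 : ∫⁻ x, f x = 1) (hg1 : ∫⁻ x, g x = 1)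
    (hh0 : ∀ x, h x ≠ 0) :
    ENNReal.ofReal (trilinearConst α β γ) * (∫⁻ x, h x) ^ γ ≤
      ∫⁻ y, ∫⁻ z, f y ^ α * (g z ^ β * h (y + z) ^ γ) := by
  set θ := (1 - α) / γ with hθdef
  have hθ : 0 < θ := div_pos_of_neg_of_neg (by linarith) hγ
  have hθ1 : θ < 1 := by rw [hθdef, div_lt_one_of_neg hγ]; linarith
  have hθ' : 0 < 1 - θ := by linarith
  have eα : 1 - α = θ * γ := by rw [hθdef, div_mul_cancel₀ _ hγ.ne]
  have eβ : 1 - β = (1 - θ) * γ := by linarith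
  obtain ⟨y, D, hy, hym, hDm, hD, key⟩ := exists_transport_shear hf hg hf1 hg1
    (by linarith : 0 < α) (by linarith : 0 < β) hθ hθ1
  rw [key (fun x => h x ^ γ) (by fun_prop)]
  have inner : ∀ X, (∫⁻ Y : ℝ, ENNReal.ofReal (Real.exp (-(Y ^ 2 / (1 - γ))))) ^ (1 - γ) *
        (∫⁻ x, h x) ^ γ ≤
      ∫⁻ Y, ENNReal.ofReal (Real.exp (-Y ^ 2)) * (D X Y * h (y X Y) ^ γ) := by
    intro X
    have hyX := (hy X).measurable
    have hdX := measurable_deriv (y X)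
    have hd0 : ∀ᵐ Y, ENNReal.ofReal (deriv (y X) Y) ≠ 0 := by
      filter_upwards [hD X] with Y ⟨s, t, hs, ht, hd, hDe⟩
      rw [hd]
      exact (ENNReal.ofReal_pos.2 (by positivity)).ne'
    calc _ ≤ (∫⁻ Y : ℝ, ENNReal.ofReal (Real.exp (-(Y ^ 2 / (1 - γ))))) ^ (1 - γ) *
          (∫⁻ Y, ENNReal.ofReal (deriv (y X) Y) * h (y X Y)) ^ γ := by
          exact mul_le_mul_right (ENNReal.rpow_le_rpow_of_nonpos hγ.le
            (lintegral_deriv_mul_comp_le_of_monotone (hy X) h)) _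
      _ ≤ ∫⁻ Y, ENNReal.ofReal (Real.exp (-(Y ^ 2 / (1 - γ)))) ^ (1 - γ) *
          (ENNReal.ofReal (deriv (y X) Y) * h (y X Y)) ^ γ := by
          refine le_lintegral_mul_rpow_of_nonpos (by fun_prop) (by fun_prop) ?_ hγ.le (by ring)
          filter_upwards [hd0] with Y hY using mul_ne_zero hY (hh0 _)
      _ ≤ _ := by
          refine lintegral_mono_ae ?_
          filter_upwards [hD X, hd0] with Y ⟨s, t, hs, ht, hd, hDe⟩ hY
          rw [ofReal_exp_neg_sq_eq_rpow (by linarith : 0 < 1 - γ),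
            ENNReal.mul_rpow_of_ne_zero hY (hh0 _), hDe, hd,
            rpow_mul_rpow_eq_geom_mean hs ht eα eβ,
            ENNReal.ofReal_rpow_of_pos (by positivity : 0 < θ * s + (1 - θ) * t)]
          refine mul_le_mul_right (mul_le_mul_left (ENNReal.ofReal_le_ofReal ?_) _) _
          exact Real.rpow_le_rpow_of_nonpos (by positivity)
            (geom_mean_le_arith_mean_pair hs ht hθ hθ1) hγ.le
  calc _ = _ := by
        rw [trilinearConst, ← lintegral_gaussian_mul_const hθ hθ1 (by linarith) (by positivity)]
    _ ≤ _ := mul_le_mul_right (lintegral_mono fun X => mul_le_mul_right (inner X) _) _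

lemma ENNReal.rpow_eq_mul_inv_mul_rpow {a c : ℝ≥0∞} (hc0 : c ≠ 0) (hc : c ≠ ∞) {α : ℝ}
    (hα : 0 ≤ α) : a ^ α = c ^ α * (c⁻¹ * a) ^ α := by
  rw [← ENNReal.mul_rpow_of_nonneg _ _ hα, ← mul_assoc, ENNReal.mul_inv_cancel hc0 hc, one_mul]

lemma lintegral_trilinear_normalize {f g h : ℝ → ℝ≥0∞} {a b : ℝ≥0∞} (ha0 : a ≠ 0) (ha : a ≠ ∞)
    (hb0 : b ≠ 0) (hb : b ≠ ∞) {α β γ : ℝ} (hα : 0 ≤ α) (hβ : 0 ≤ β) :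
    ∫⁻ y, ∫⁻ z, f y ^ α * (g z ^ β * h (y + z) ^ γ) =
      a ^ α * (b ^ β * ∫⁻ y, ∫⁻ z, (a⁻¹ * f y) ^ α * ((b⁻¹ * g z) ^ β * h (y + z) ^ γ)) := by
  have ha' : a ^ α ≠ ∞ := ENNReal.rpow_ne_top_of_nonneg hα ha
  have hb' : b ^ β ≠ ∞ := ENNReal.rpow_ne_top_of_nonneg hβ hb
  rw [← mul_assoc, ← lintegral_const_mul' _ _ (ENNReal.mul_ne_top ha' hb')]
  refine lintegral_congr fun y => ?_
  rw [← lintegral_const_mul' _ _ (ENNReal.mul_ne_top ha' hb')]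
  refine lintegral_congr fun z => ?_
  rw [ENNReal.rpow_eq_mul_inv_mul_rpow ha0 ha hα (a := f y),
    ENNReal.rpow_eq_mul_inv_mul_rpow hb0 hb hβ (a := g z)]
  ring

lemma youngBound_real {α β γ : ℝ} (hα : 0 < α) (hα1 : α < 1) (hβ : 0 < β) (hβ1 : β < 1)
    (hγ : 0 < γ) (hγ1 : γ < 1) (hsum : α + β + γ = 2) :
    YoungBound ℝ α β γ (ENNReal.ofReal (trilinearConst α β γ)) := by
  intro f g h hf hg hh hft hgt
  rcases eq_or_ne (∫⁻ y, f y) 0 with hf0 | hf0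
  · refine le_of_eq_of_le ?_ zero_le
    rw [lintegral_eq_zero_iff hf] at hf0
    refine (lintegral_congr_ae (g := fun _ => 0) ?_).trans (by simp)
    filter_upwards [hf0] with y hy
    simp [hy, hα]
  rcases eq_or_ne (∫⁻ y, g y) 0 with hg0 | hg0
  · refine le_of_eq_of_le ?_ zero_le
    rw [lintegral_eq_zero_iff hg] at hg0
    refine (lintegral_congr (g := fun _ => 0) fun y => ?_).trans (by simp)
    refine (lintegral_congr_ae (g := fun _ => 0) ?_).trans (by simp)
    filter_upwards [hg0] with z hz
    simp [hz, hβ]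
  have hfn : ∫⁻ y, (∫⁻ y, f y)⁻¹ * f y = 1 := by
    rw [lintegral_const_mul _ hf, ENNReal.inv_mul_cancel hf0 hft]
  have hgn : ∫⁻ y, (∫⁻ y, g y)⁻¹ * g y = 1 := by
    rw [lintegral_const_mul _ hg, ENNReal.inv_mul_cancel hg0 hgt]
  rw [lintegral_trilinear_normalize hf0 hft hg0 hgt hα.le hβ.le]
  calc _ ≤ _ := mul_le_mul_right (mul_le_mul_right (youngBound_real_aux hα hα1 hβ hβ1 hγ hγ1 hsum
        (hf.const_mul _) (hg.const_mul _) hh hfn hgn) _) _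
    _ = _ := by ring

lemma reverseYoungBound_real {α β γ : ℝ} (hα1 : 1 < α) (hβ1 : 1 < β)
    (hγ : γ < 0) (hsum : α + β + γ = 2) :
    ReverseYoungBound ℝ α β γ (ENNReal.ofReal (trilinearConst α β γ)) := by
  intro f g h hf hg hh hft hgt hh0
  have hα : 0 < α := by linarith
  have hβ : 0 < β := by linarith
  rcases eq_or_ne (∫⁻ y, f y) 0 with hf0 | hf0
  · simp [hf0, hα]
  rcases eq_or_ne (∫⁻ y, g y) 0 with hg0 | hg0
  · simp [hg0, hβ]
  have hfn : ∫⁻ y, (∫⁻ y, f y)⁻¹ * f y = 1 := by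
    rw [lintegral_const_mul _ hf, ENNReal.inv_mul_cancel hf0 hft]
  have hgn : ∫⁻ y, (∫⁻ y, g y)⁻¹ * g y = 1 := by
    rw [lintegral_const_mul _ hg, ENNReal.inv_mul_cancel hg0 hgt]
  rw [lintegral_trilinear_normalize (f := f) (g := g) hf0 hft hg0 hgt hα.le hβ.le]
  calc _ = _ := by ring
    _ ≤ _ := mul_le_mul_right (mul_le_mul_right (reverseYoungBound_real_aux hα1 hβ1 hγ hsum
        (hf.const_mul _) (hg.const_mul _) hh hfn hgn hh0) _) _

/-! ### Endpoint exponents and tensorization -/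

section Tensorization

variable {E E' : Type*} [MeasureSpace E] [MeasureSpace E']

lemma YoungBound.symm [AddCommMagma E] [MeasurableAdd₂ E] [SFinite (volume : Measure E)]
    {α β γ : ℝ} {K : ℝ≥0∞} (h : YoungBound E α β γ K) : YoungBound E β α γ K := by
  intro f g k hf hg hk hft hgt
  rw [lintegral_lintegral_swap (by simp only [Function.uncurry_def]; fun_prop)]
  convert h g f k hg hf hk hgt hft using 1
  · refine lintegral_congr fun y => lintegral_congr fun z => ?_
    rw [add_comm z y]; ring
  · ring

lemma ReverseYoungBound.symm [AddCommMagma E] [MeasurableAdd₂ E] [SFinite (volume : Measure E)]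
    {α β γ : ℝ} {K : ℝ≥0∞} (h : ReverseYoungBound E α β γ K) : ReverseYoungBound E β α γ K := by
  intro f g k hf hg hk hft hgt hk0
  rw [lintegral_lintegral_swap (by simp only [Function.uncurry_def]; fun_prop)]
  convert h g f k hg hf hk hgt hft hk0 using 1
  · ring
  · refine lintegral_congr fun y => lintegral_congr fun z => ?_
    rw [add_comm z y]; ring

/-- At α = 1 the transport parameter θ would be 0. Here Hölder in z suffices, since translation
invariance makes the resulting bound independent of y. -/
lemma youngBound_one [AddGroup E] [MeasurableAdd₂ E] [(volume : Measure E).IsAddLeftInvariant]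
    {β γ : ℝ} (hβ : 0 ≤ β) (hγ : 0 ≤ γ) (hsum : β + γ = 1) : YoungBound E 1 β γ 1 := by
  intro f g k hf hg hk hft hgt
  calc _ = ∫⁻ y, f y * ∫⁻ z, g z ^ β * k (y + z) ^ γ := by
        refine lintegral_congr fun y => ?_
        rw [ENNReal.rpow_one, lintegral_const_mul _ (by fun_prop)]
    _ ≤ ∫⁻ y, f y * ((∫⁻ z, g z) ^ β * (∫⁻ x, k x) ^ γ) := by
        refine lintegral_mono fun y => mul_le_mul_right ?_ _
        refine (ENNReal.lintegral_mul_norm_pow_le (by fun_prop) (by fun_prop) hβ hγ hsum).trans_eq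
          ?_
        rw [lintegral_add_left_eq_self]
    _ = _ := by rw [lintegral_mul_const _ hf, ENNReal.rpow_one, one_mul]

lemma reverseYoungBound_one [AddGroup E] [MeasurableAdd₂ E]
    [(volume : Measure E).IsAddLeftInvariant]
    {β γ : ℝ} (hγ : γ ≤ 0) (hsum : β + γ = 1) : ReverseYoungBound E 1 β γ 1 := by
  intro f g k hf hg hk hft hgt hk0
  calc _ = ∫⁻ y, f y * ((∫⁻ z, g z) ^ β * (∫⁻ x, k x) ^ γ) := by
        rw [lintegral_mul_const _ hf, ENNReal.rpow_one, one_mul]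
    _ ≤ ∫⁻ y, f y * ∫⁻ z, g z ^ β * k (y + z) ^ γ := by
        refine lintegral_mono fun y => mul_le_mul_right ?_ _
        refine le_of_eq_of_le ?_ (le_lintegral_mul_rpow_of_nonpos (by fun_prop) (by fun_prop)
          (ae_of_all _ fun z => hk0 (y + z)) hγ hsum)
        rw [lintegral_add_left_eq_self]
    _ = _ := by
        refine lintegral_congr fun y => ?_
        rw [ENNReal.rpow_one, lintegral_const_mul _ (by fun_prop)]

lemma lintegral_prod_lintegral_prod [SFinite (volume : Measure E)] [SFinite (volume : Measure E')]
    {Φ : E × E' → E × E' → ℝ≥0∞} (hΦ : Measurable (Function.uncurry Φ)) :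
    ∫⁻ p, ∫⁻ q, Φ p q = ∫⁻ y, ∫⁻ z, ∫⁻ s, ∫⁻ t, Φ (y, s) (z, t) := by
  have h1 : ∀ p, ∫⁻ q, Φ p q = ∫⁻ z, ∫⁻ t, Φ p (z, t) := fun p =>
    lintegral_prod _ (hΦ.comp (measurable_const.prodMk measurable_id)).aemeasurable
  have h2 : Measurable fun w : (E × E') × E => ∫⁻ t, Φ w.1 (w.2, t) :=
    Measurable.lintegral_prod_right' (f := fun w : ((E × E') × E) × E' => Φ w.1.1 (w.1.2, w.2))
      (hΦ.comp (show Measurable fun w : ((E × E') × E) × E' => (w.1.1, (w.1.2, w.2)) by fun_prop))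
  simp_rw [h1]
  rw [Measure.volume_eq_prod, lintegral_prod _ h2.lintegral_prod_right'.aemeasurable]
  refine lintegral_congr fun y => ?_
  exact lintegral_lintegral_swap
    (h2.comp (show Measurable fun w : E' × E => ((y, w.1), w.2) by fun_prop)).aemeasurable

/-- Apply the bound on `E'` to slices with the first coordinates fixed. Its right side is again a
trilinear integrand with the same exponents, now in the marginals, to which the bound on `E`
applies. -/
lemma YoungBound.prod [Add E] [Add E'] [MeasurableAdd₂ E] [MeasurableAdd₂ E']
    [SFinite (volume : Measure E)] [SFinite (volume : Measure E')]
    {α β γ : ℝ} {K K' : ℝ≥0∞} (hE : YoungBound E α β γ K) (hE' : YoungBound E' α β γ K')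
    (hK' : K' ≠ ∞) : YoungBound (E × E') α β γ (K * K') := by
  intro f g k hf hg hk hft hgt
  have pf := lintegral_prod (μ := (volume : Measure E)) (ν := (volume : Measure E')) f
    hf.aemeasurable
  have pg := lintegral_prod (μ := (volume : Measure E)) (ν := (volume : Measure E')) g
    hg.aemeasurable
  have pk := lintegral_prod (μ := (volume : Measure E)) (ν := (volume : Measure E')) k
    hk.aemeasurable
  rw [← Measure.volume_eq_prod] at pf pg pk
  have mf := hf.lintegral_prod_right' (ν := (volume : Measure E'))
  have mg := hg.lintegral_prod_right' (ν := (volume : Measure E'))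
  have mk := hk.lintegral_prod_right' (ν := (volume : Measure E'))
  rw [pf] at hft ⊢
  rw [pg] at hgt ⊢
  have madd : Measurable fun p : (E × E') × (E × E') => p.1 + p.2 :=
    (show Measurable fun p : (E × E') × (E × E') => (p.1.1 + p.2.1, p.1.2 + p.2.2) by fun_prop)
  have mk2 := hk.comp madd
  rw [pk, lintegral_prod_lintegral_prod (((hf.comp measurable_fst).pow_const α).mul
    (((hg.comp measurable_snd).pow_const β).mul (mk2.pow_const γ)))]
  calc _ ≤ ∫⁻ y, ∫⁻ z, K' * ((∫⁻ s, f (y, s)) ^ α * ((∫⁻ t, g (z, t)) ^ β *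
          (∫⁻ r, k (y + z, r)) ^ γ)) := by
        refine lintegral_mono_ae ?_
        filter_upwards [ae_lt_top mf hft] with y hy
        refine lintegral_mono_ae ?_
        filter_upwards [ae_lt_top mg hgt] with z hz
        exact hE' (fun s => f (y, s)) (fun t => g (z, t)) (fun r => k (y + z, r))
          (by fun_prop) (by fun_prop) (by fun_prop) hy.ne hz.ne
    _ = K' * ∫⁻ y, ∫⁻ z, ((∫⁻ s, f (y, s)) ^ α * ((∫⁻ t, g (z, t)) ^ β *
          (∫⁻ r, k (y + z, r)) ^ γ)) := by
        rw [← lintegral_const_mul' _ _ hK']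
        refine lintegral_congr fun y => ?_
        rw [← lintegral_const_mul' _ _ hK']
    _ ≤ _ := mul_le_mul_right (hE _ _ _ mf mg mk hft hgt) _
    _ = _ := by ring

lemma ReverseYoungBound.prod [Add E] [Add E'] [MeasurableAdd₂ E] [MeasurableAdd₂ E']
    [SFinite (volume : Measure E)] [SFinite (volume : Measure E')] [NeZero (volume : Measure E')]
    {α β γ : ℝ} {K K' : ℝ≥0∞} (hE : ReverseYoungBound E α β γ K)
    (hE' : ReverseYoungBound E' α β γ K')
    (hK' : K' ≠ ∞) : ReverseYoungBound (E × E') α β γ (K * K') := by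
  intro f g k hf hg hk hft hgt hk0
  have pf := lintegral_prod (μ := (volume : Measure E)) (ν := (volume : Measure E')) f
    hf.aemeasurable
  have pg := lintegral_prod (μ := (volume : Measure E)) (ν := (volume : Measure E')) g
    hg.aemeasurable
  have pk := lintegral_prod (μ := (volume : Measure E)) (ν := (volume : Measure E')) k
    hk.aemeasurable
  rw [← Measure.volume_eq_prod] at pf pg pk
  have mf := hf.lintegral_prod_right' (ν := (volume : Measure E'))
  have mg := hg.lintegral_prod_right' (ν := (volume : Measure E'))
  have mk := hk.lintegral_prod_right' (ν := (volume : Measure E'))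
  -- The reverse bound on `E` needs a nowhere vanishing third function; the marginal of `k` is one
  -- because the volume of `E'` is nonzero.
  have hne : ∀ x, ∫⁻ r, k (x, r) ≠ 0 := fun x h => by
    rw [lintegral_eq_zero_iff (by fun_prop)] at h
    have : ∀ᵐ r : E', False := by
      filter_upwards [h] with r hr using hk0 _ hr
    rw [Filter.eventually_false_iff_eq_bot, ae_eq_bot] at this
    exact NeZero.ne _ this
  rw [pf] at hft ⊢
  rw [pg] at hgt ⊢
  have madd : Measurable fun p : (E × E') × (E × E') => p.1 + p.2 :=
    (show Measurable fun p : (E × E') × (E × E') => (p.1.1 + p.2.1, p.1.2 + p.2.2) by fun_prop)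
  have mk2 := hk.comp madd
  rw [pk, lintegral_prod_lintegral_prod (((hf.comp measurable_fst).pow_const α).mul
    (((hg.comp measurable_snd).pow_const β).mul (mk2.pow_const γ)))]
  calc _ = K' * (K * _) := by ring
    _ ≤ _ := mul_le_mul_right (hE _ _ _ mf mg mk hft hgt hne) _
    _ = ∫⁻ y, ∫⁻ z, K' * ((∫⁻ s, f (y, s)) ^ α * ((∫⁻ t, g (z, t)) ^ β *
          (∫⁻ r, k (y + z, r)) ^ γ)) := by
        rw [← lintegral_const_mul' _ _ hK']
        refine lintegral_congr fun y => ?_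
        rw [← lintegral_const_mul' _ _ hK']
    _ ≤ _ := by
        refine lintegral_mono_ae ?_
        filter_upwards [ae_lt_top mf hft] with y hy
        refine lintegral_mono_ae ?_
        filter_upwards [ae_lt_top mg hgt] with z hz
        exact hE' (fun s => f (y, s)) (fun t => g (z, t)) (fun r => k (y + z, r))
          (by fun_prop) (by fun_prop) (by fun_prop) hy.ne hz.ne fun r => hk0 _

lemma lintegral_trilinear_comp [Add E] [Add E'] (e : E ≃ᵐ E') (he : MeasurePreserving e)
    (hadd : ∀ x y, e (x + y) = e x + e y) (f g k : E' → ℝ≥0∞) (α β γ : ℝ) :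
    ∫⁻ y, ∫⁻ z, f (e y) ^ α * (g (e z) ^ β * k (e (y + z)) ^ γ) =
      ∫⁻ y, ∫⁻ z, f y ^ α * (g z ^ β * k (y + z) ^ γ) := by
  rw [← he.lintegral_comp_emb e.measurableEmbedding]
  refine lintegral_congr fun y => ?_
  rw [← he.lintegral_comp_emb e.measurableEmbedding]
  simp_rw [hadd]

lemma YoungBound.of_equiv [Add E] [Add E'] (e : E ≃ᵐ E') (he : MeasurePreserving e)
    (hadd : ∀ x y, e (x + y) = e x + e y) {α β γ : ℝ} {K : ℝ≥0∞} (h : YoungBound E α β γ K) :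
    YoungBound E' α β γ K := by
  intro f g k hf hg hk hft hgt
  have hc : ∀ f : E' → ℝ≥0∞, ∫⁻ x, f (e x) = ∫⁻ x, f x := fun f =>
    he.lintegral_comp_emb e.measurableEmbedding f
  rw [← hc f] at hft ⊢
  rw [← hc g] at hgt ⊢
  rw [← hc k, ← lintegral_trilinear_comp e he hadd]
  exact h (fun x => f (e x)) (fun x => g (e x)) (fun x => k (e x)) (hf.comp e.measurable)
    (hg.comp e.measurable) (hk.comp e.measurable) hft hgt

lemma ReverseYoungBound.of_equiv [Add E] [Add E'] (e : E ≃ᵐ E') (he : MeasurePreserving e)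
    (hadd : ∀ x y, e (x + y) = e x + e y) {α β γ : ℝ} {K : ℝ≥0∞}
    (h : ReverseYoungBound E α β γ K) : ReverseYoungBound E' α β γ K := by
  intro f g k hf hg hk hft hgt hk0
  have hc : ∀ f : E' → ℝ≥0∞, ∫⁻ x, f (e x) = ∫⁻ x, f x := fun f =>
    he.lintegral_comp_emb e.measurableEmbedding f
  rw [← hc f] at hft ⊢
  rw [← hc g] at hgt ⊢
  rw [← hc k, ← lintegral_trilinear_comp e he hadd]
  exact h (fun x => f (e x)) (fun x => g (e x)) (fun x => k (e x)) (hf.comp e.measurable)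
    (hg.comp e.measurable) (hk.comp e.measurable) hft hgt fun x => hk0 _

end Tensorization

lemma piFinSuccAbove_symm_add (n : ℕ) (x y : ℝ × (Fin n → ℝ)) :
    (MeasurableEquiv.piFinSuccAbove (fun _ : Fin (n + 1) => ℝ) 0).symm (x + y) =
      (MeasurableEquiv.piFinSuccAbove (fun _ : Fin (n + 1) => ℝ) 0).symm x +
      (MeasurableEquiv.piFinSuccAbove (fun _ : Fin (n + 1) => ℝ) 0).symm y := by
  set e := MeasurableEquiv.piFinSuccAbove (fun _ : Fin (n + 1) => ℝ) 0
  have h : ∀ a b, e (a + b) = e a + e b := fun a b => rfl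
  apply e.injective
  rw [h]
  simp

lemma YoungBound.pi {α β γ : ℝ} {K : ℝ≥0∞} (hK : K ≠ ∞) (h : YoungBound ℝ α β γ K) (n : ℕ) :
    YoungBound (Fin n → ℝ) α β γ (K ^ n) := by
  induction n with
  | zero =>
    intro f g k _ _ _ _ _
    have hv : (volume : Measure (Fin 0 → ℝ)) univ = 1 := by
      rw [volume_pi, Measure.pi_of_empty _ 0]; simp
    simp only [lintegral_unique, hv, mul_one, pow_zero, one_mul]
    exact le_of_eq (by congr!)
  | succ n ih =>
    rw [pow_succ']
    exact (h.prod ih (ENNReal.pow_ne_top hK)).of_equiv _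
      (volume_preserving_piFinSuccAbove (fun _ : Fin (n + 1) => ℝ) 0).symm
      (piFinSuccAbove_symm_add n)

lemma ReverseYoungBound.pi {α β γ : ℝ} {K : ℝ≥0∞} (hK : K ≠ ∞) (h : ReverseYoungBound ℝ α β γ K)
    (n : ℕ) : ReverseYoungBound (Fin n → ℝ) α β γ (K ^ n) := by
  induction n with
  | zero =>
    intro f g k _ _ _ _ _ _
    have hv : (volume : Measure (Fin 0 → ℝ)) univ = 1 := by
      rw [volume_pi, Measure.pi_of_empty _ 0]; simp
    simp only [lintegral_unique, hv, mul_one, pow_zero, one_mul]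
    exact le_of_eq (by congr!)
  | succ n ih =>
    rw [pow_succ']
    exact (h.prod ih (ENNReal.pow_ne_top hK)).of_equiv _
      (volume_preserving_piFinSuccAbove (fun _ : Fin (n + 1) => ℝ) 0).symm
      (piFinSuccAbove_symm_add n)

lemma YoungBound.euclideanSpace {α β γ : ℝ} {K : ℝ≥0∞} (hK : K ≠ ∞) (h : YoungBound ℝ α β γ K)
    (n : ℕ) : YoungBound (EuclideanSpace ℝ (Fin n)) α β γ (K ^ n) :=
  (h.pi hK n).of_equiv (MeasurableEquiv.toLp 2 (Fin n → ℝ))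
    (EuclideanSpace.volume_preserving_symm_measurableEquiv_toLp (Fin n)).symm fun _ _ => rfl

lemma ReverseYoungBound.euclideanSpace {α β γ : ℝ} {K : ℝ≥0∞} (hK : K ≠ ∞)
    (h : ReverseYoungBound ℝ α β γ K)
    (n : ℕ) : ReverseYoungBound (EuclideanSpace ℝ (Fin n)) α β γ (K ^ n) :=
  (h.pi hK n).of_equiv (MeasurableEquiv.toLp 2 (Fin n → ℝ))
    (EuclideanSpace.volume_preserving_symm_measurableEquiv_toLp (Fin n)).symm fun _ _ => rfl

/-! ### Duality: from trilinear bounds to norms of convolutions -/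

section Convolution

variable {E : Type*} [MeasureSpace E] [AddCommGroup E] [MeasurableAdd₂ E] [MeasurableNeg E]
  [SigmaFinite (volume : Measure E)]

lemma measurable_lintegral_conv {f g : E → ℝ≥0∞} (hf : Measurable f)
    (hg : Measurable g) (α β : ℝ) : Measurable fun x => ∫⁻ y, f y ^ α * g (x - y) ^ β :=
  Measurable.lintegral_prod_right' (f := fun w : E × E => f w.2 ^ α * g (w.1 - w.2) ^ β)
    (by fun_prop)

variable [(volume : Measure E).IsAddLeftInvariant]

lemma lintegral_trilinear_eq_lintegral_conv {f g h : E → ℝ≥0∞} (hf : Measurable f)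
    (hg : Measurable g) (hh : Measurable h) (α β γ : ℝ) :
    ∫⁻ y, ∫⁻ z, f y ^ α * (g z ^ β * h (y + z) ^ γ) =
      ∫⁻ x, (∫⁻ y, f y ^ α * g (x - y) ^ β) * h x ^ γ := by
  have h1 : ∀ y, ∫⁻ z, f y ^ α * (g z ^ β * h (y + z) ^ γ) =
      ∫⁻ x, f y ^ α * g (x - y) ^ β * h x ^ γ := fun y => by
    rw [← lintegral_sub_right_eq_self _ y]
    refine lintegral_congr fun x => ?_
    rw [add_sub_cancel, mul_assoc]
  have h2 : ∀ x, (∫⁻ y, f y ^ α * g (x - y) ^ β) * h x ^ γ =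
      ∫⁻ y, f y ^ α * g (x - y) ^ β * h x ^ γ := fun x =>
    (lintegral_mul_const _ (by fun_prop)).symm
  simp_rw [h1, h2]
  exact lintegral_lintegral_swap (by simp only [Function.uncurry_def]; fun_prop)

/-- As 1 + pγ = p, testing with h = c^p gives ∫ c^p ≤ A (∫ c^p)^γ. Division needs a finite integral,
so c is truncated in height and support, and Fatou removes the truncation. -/
lemma YoungBound.lintegral_conv_rpow_le {α β γ p : ℝ} {K : ℝ≥0∞} (hY : YoungBound E α β γ K)
    (hγ : 0 ≤ γ) (hp : 0 < p) (hpγ : p * (1 - γ) = 1) {f g : E → ℝ≥0∞} (hf : Measurable f)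
    (hg : Measurable g) (hft : ∫⁻ x, f x ≠ ∞) (hgt : ∫⁻ x, g x ≠ ∞) :
    (∫⁻ x, (∫⁻ y, f y ^ α * g (x - y) ^ β) ^ p) ^ (1 - γ) ≤
      K * ((∫⁻ x, f x) ^ α * (∫⁻ x, g x) ^ β) := by
  have hγ1 : 0 < 1 - γ := (pos_iff_pos_of_mul_pos (by rw [hpγ]; exact one_pos)).1 hp
  set c : E → ℝ≥0∞ := fun x => ∫⁻ y, f y ^ α * g (x - y) ^ β with hc
  have hcm : Measurable c := measurable_lintegral_conv hf hg α β
  set A := K * ((∫⁻ x, f x) ^ α * (∫⁻ x, g x) ^ β)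
  let S := spanningSets (volume : Measure E)
  have hS : ∀ n, MeasurableSet (S n) := measurableSet_spanningSets _
  let h : ℕ → E → ℝ≥0∞ := fun n => (S n).indicator fun x => min (c x) n ^ p
  have hhm : ∀ n, Measurable (h n) := fun n =>
    (((hcm.min measurable_const).pow_const p).indicator (hS n))
  have hfin : ∀ n, ∫⁻ x, h n x ≠ ∞ := fun n => by
    rw [lintegral_indicator (hS n)]
    refine ((setLIntegral_mono (g := fun _ => (n : ℝ≥0∞) ^ p) measurable_const
      fun x _ => ?_).trans_lt ?_).ne
    · gcongr; exact min_le_right _ _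
    · rw [setLIntegral_const]
      exact ENNReal.mul_lt_top (ENNReal.rpow_lt_top_of_nonneg hp.le (ENNReal.natCast_ne_top n))
        (measure_spanningSets_lt_top _ n)
  have hle : ∀ n x, h n x ≤ c x * h n x ^ γ := fun n x => by
    by_cases hx : x ∈ S n
    · simp only [h, indicator_of_mem hx]
      calc min (c x) n ^ p = min (c x) n ^ (1 + p * γ) := by congr 1; linarith
        _ = min (c x) n * (min (c x) n ^ p) ^ γ := by
            rw [ENNReal.rpow_add_of_nonneg _ _ zero_le_one (by positivity), ENNReal.rpow_one,
              ENNReal.rpow_mul]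
        _ ≤ _ := by gcongr; exact min_le_left _ _
    · simp [h, hx]
  have hbound : ∀ n, ∫⁻ x, h n x ≤ A ^ p := fun n => by
    rcases eq_or_ne (∫⁻ x, h n x) 0 with h0 | h0
    · rw [h0]; exact zero_le
    have h1 : ∫⁻ x, h n x ≤ A * (∫⁻ x, h n x) ^ γ :=
      calc ∫⁻ x, h n x ≤ ∫⁻ x, c x * h n x ^ γ := lintegral_mono (hle n)
        _ = _ := (lintegral_trilinear_eq_lintegral_conv hf hg (hhm n) α β γ).symm
        _ ≤ _ := hY f g (h n) hf hg (hhm n) hft hgt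
        _ = _ := by simp only [A]; ring
    have h2 : (∫⁻ x, h n x) ^ (1 - γ) ≤ A := by
      rw [ENNReal.rpow_sub _ _ h0 (hfin n), ENNReal.rpow_one]
      exact ENNReal.div_le_of_le_mul h1
    calc ∫⁻ x, h n x = ((∫⁻ x, h n x) ^ (1 - γ)) ^ p := by
          rw [← ENNReal.rpow_mul, mul_comm, hpγ, ENNReal.rpow_one]
      _ ≤ _ := by gcongr
  have hlim : ∀ x, Tendsto (fun n => h n x) atTop (𝓝 (c x ^ p)) := fun x => by
    have h1 : Tendsto (fun n : ℕ => min (c x) n ^ p) atTop (𝓝 (c x ^ p)) := by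
      have : Tendsto (fun n : ℕ => min (c x) (n : ℝ≥0∞)) atTop (𝓝 (min (c x) ∞)) :=
        tendsto_const_nhds.min ENNReal.tendsto_nat_nhds_top
      rw [min_eq_left le_top] at this
      exact (ENNReal.continuous_rpow_const.tendsto _).comp this
    refine h1.congr' ?_
    filter_upwards [eventually_ge_atTop (spanningSetsIndex volume x)] with n hn
    have hx : x ∈ S n := monotone_spanningSets _ hn (mem_spanningSetsIndex _ x)
    simp only [h, indicator_of_mem hx]
  have hI : ∫⁻ x, c x ^ p ≤ A ^ p :=
    calc ∫⁻ x, c x ^ p = ∫⁻ x, liminf (fun n => h n x) atTop :=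
          lintegral_congr fun x => (hlim x).liminf_eq.symm
      _ ≤ liminf (fun n => ∫⁻ x, h n x) atTop := lintegral_liminf_le hhm
      _ ≤ A ^ p := liminf_le_of_frequently_le' (Frequently.of_forall hbound)
  calc _ ≤ (A ^ p) ^ (1 - γ) := by gcongr
    _ = A := by rw [← ENNReal.rpow_mul, hpγ, ENNReal.rpow_one]

/-- The test function c^p may vanish, so a positive function of integral below ε is added. With I =
∫ c^p finite this gives A (I+ε)^γ ≤ I+ε, and ε → 0. -/
lemma ReverseYoungBound.le_lintegral_conv_rpow {α β γ p : ℝ} {K : ℝ≥0∞}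
    (hY : ReverseYoungBound E α β γ K)
    (hγ : γ ≤ 0) (hp : 0 < p) (hpγ : p * (1 - γ) = 1) {f g : E → ℝ≥0∞} (hf : Measurable f)
    (hg : Measurable g) (hft : ∫⁻ x, f x ≠ ∞) (hgt : ∫⁻ x, g x ≠ ∞) :
    K * ((∫⁻ x, f x) ^ α * (∫⁻ x, g x) ^ β) ≤
      (∫⁻ x, (∫⁻ y, f y ^ α * g (x - y) ^ β) ^ p) ^ (1 - γ) := by
  set c : E → ℝ≥0∞ := fun x => ∫⁻ y, f y ^ α * g (x - y) ^ β with hc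
  have hcm : Measurable c := measurable_lintegral_conv hf hg α β
  set A := K * ((∫⁻ x, f x) ^ α * (∫⁻ x, g x) ^ β)
  set I := ∫⁻ x, c x ^ p with hIdef
  have hγ1 : 0 < 1 - γ := by linarith
  rcases eq_or_ne I ∞ with hI | hI
  · rw [hI, ENNReal.top_rpow_of_pos hγ1]; exact le_top
  have hlim : Tendsto (fun ε : ℝ≥0∞ => (I + ε) ^ (1 - γ)) (𝓝[>] 0) (𝓝 (I ^ (1 - γ))) := by
    have h1 : Tendsto (fun ε : ℝ≥0∞ => I + ε) (𝓝[>] 0) (𝓝 (I + 0)) :=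
      (tendsto_const_nhds.add tendsto_id).mono_left nhdsWithin_le_nhds
    rw [add_zero] at h1
    exact (ENNReal.continuous_rpow_const.tendsto _).comp h1
  refine ge_of_tendsto hlim ?_
  filter_upwards [self_mem_nhdsWithin, nhdsWithin_le_nhds (gt_mem_nhds ENNReal.zero_lt_top)]
    with ε hε hεt
  obtain ⟨φ, hφ0, hφm, hφ⟩ := exists_pos_lintegral_lt_of_sigmaFinite (volume : Measure E)
    (ne_of_gt hε)
  let h : E → ℝ≥0∞ := fun x => c x ^ p + φ x
  have hφm' : Measurable fun x => (φ x : ℝ≥0∞) := hφm.coe_nnreal_ennreal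
  have hhm : Measurable h := (hcm.pow_const p).add hφm'
  have hh0 : ∀ x, h x ≠ 0 := fun x hx => by
    have := (add_eq_zero.1 hx).2
    exact (hφ0 x).ne' (by exact_mod_cast this)
  have hhI : ∫⁻ x, h x ≤ I + ε := by
    rw [lintegral_add_left (hcm.pow_const p)]
    gcongr
  have hle : ∀ x, c x * h x ^ γ ≤ c x ^ p := fun x => by
    rcases eq_or_ne (c x) 0 with h0 | h0
    · simp [h0]
    rcases eq_or_ne (c x) ∞ with ht | ht
    · rw [ht, ENNReal.top_rpow_of_pos hp]; exact le_top
    calc c x * h x ^ γ ≤ c x * (c x ^ p) ^ γ :=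
          mul_le_mul_right (ENNReal.rpow_le_rpow_of_nonpos hγ le_self_add) _
      _ = c x ^ p := by
          nth_rw 1 [← ENNReal.rpow_one (c x)]
          rw [← ENNReal.rpow_mul, ← ENNReal.rpow_add _ _ h0 ht]
          congr 1; linarith
  have hmain : A * (I + ε) ^ γ ≤ I + ε :=
    calc A * (I + ε) ^ γ ≤ A * (∫⁻ x, h x) ^ γ :=
          mul_le_mul_right (ENNReal.rpow_le_rpow_of_nonpos hγ hhI) _
      _ = _ := by simp only [A]; ring
      _ ≤ _ := hY f g h hf hg hhm hft hgt hh0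
      _ = ∫⁻ x, c x * h x ^ γ := lintegral_trilinear_eq_lintegral_conv hf hg hhm α β γ
      _ ≤ I := lintegral_mono hle
      _ ≤ I + ε := le_self_add
  have hne : I + ε ≠ 0 := fun h => (ne_of_gt hε) (add_eq_zero.1 h).2
  have hnt : I + ε ≠ ∞ := ENNReal.add_ne_top.2 ⟨hI, hεt.ne⟩
  rw [ENNReal.rpow_sub _ _ hne hnt, ENNReal.rpow_one]
  rw [ENNReal.le_div_iff_mul_le]
  · exact hmain
  · left
    simp [ENNReal.rpow_eq_zero_iff, hne, hnt]
  · left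
    simp [ENNReal.rpow_eq_top_iff, hne, hnt]

end Convolution

/-! ### Norm inequalities on Euclidean space -/

section EuclideanSpace

variable {d : ℕ}

/-- The trilinear bounds take integrable densities: F is the q-th power of a measurable
representative of f. -/
lemma exists_measurable_rpow_rep {q : ℝ} (hq : 0 < q) {f : EuclideanSpace ℝ (Fin d) → ℝ}
    (hf0 : ∀ x, 0 ≤ f x) (hf : MemLp f (ENNReal.ofReal q) volume) :
    ∃ F : EuclideanSpace ℝ (Fin d) → ℝ≥0∞, Measurable F ∧ ∫⁻ x, F x ≠ ∞ ∧
      (∀ᵐ x, ENNReal.ofReal (f x) = F x ^ (1 / q)) ∧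
      eLpNorm f (ENNReal.ofReal q) volume = (∫⁻ x, F x) ^ (1 / q) := by
  have hq0 : ENNReal.ofReal q ≠ 0 := by simpa using hq
  obtain ⟨f', hf', hff'⟩ := hf.1
  have hI : ∫⁻ x, ENNReal.ofReal (f' x) ^ q = ∫⁻ x, ‖f x‖ₑ ^ q := by
    refine lintegral_congr_ae ?_
    filter_upwards [hff'] with x hx
    rw [← hx, Real.enorm_of_nonneg (hf0 x)]
  have hn : eLpNorm f (ENNReal.ofReal q) volume =
      (∫⁻ x, ENNReal.ofReal (f' x) ^ q) ^ (1 / q) := by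
    rw [eLpNorm_eq_lintegral_rpow_enorm_toReal hq0 ENNReal.ofReal_ne_top,
      ENNReal.toReal_ofReal hq.le, hI]
  refine ⟨fun x => ENNReal.ofReal (f' x) ^ q, by have := hf'.measurable; fun_prop, ?_, ?_, hn⟩
  · intro htop
    have := hf.2
    rw [hn, htop, ENNReal.top_rpow_of_pos (by positivity)] at this
    exact lt_irrefl _ this
  · filter_upwards [hff'] with x hx
    rw [hx, ← ENNReal.rpow_mul, mul_one_div_cancel hq.ne', ENNReal.rpow_one]

lemma eLpNorm_nnConv_eq {p α β : ℝ} (hp : 0 < p) {f g : EuclideanSpace ℝ (Fin d) → ℝ}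
    {F G : EuclideanSpace ℝ (Fin d) → ℝ≥0∞} (hF : ∀ᵐ x, ENNReal.ofReal (f x) = F x ^ α)
    (hG : ∀ᵐ x, ENNReal.ofReal (g x) = G x ^ β) :
    eLpNorm (nnConv f g) (ENNReal.ofReal p) volume =
      (∫⁻ x, (∫⁻ y, F y ^ α * G (x - y) ^ β) ^ p) ^ (1 / p) := by
  rw [eLpNorm_eq_lintegral_rpow_enorm_toReal (by simpa using hp) ENNReal.ofReal_ne_top,
    ENNReal.toReal_ofReal hp.le]
  congr 1
  refine lintegral_congr fun x => ?_
  rw [enorm_eq_self, nnConv]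
  congr 1
  refine lintegral_congr_ae ?_
  have hG' : ∀ᵐ y, ENNReal.ofReal (g (x - y)) = G (x - y) ^ β :=
    (quasiMeasurePreserving_sub_left volume x).ae hG
  filter_upwards [hF, hG'] with y h1 h2
  rw [h1, h2]

theorem eLpNorm_nnConv_le {p₁ p₂ p : ℝ} (hp₁ : 0 < p₁) (hp₂ : 0 < p₂) (hp : 1 ≤ p) {K : ℝ≥0∞}
    (hY : YoungBound (EuclideanSpace ℝ (Fin d)) (1 / p₁) (1 / p₂) (1 - 1 / p) K)
    {f g : EuclideanSpace ℝ (Fin d) → ℝ} (hf0 : ∀ x, 0 ≤ f x) (hg0 : ∀ x, 0 ≤ g x)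
    (hf : MemLp f (ENNReal.ofReal p₁) volume) (hg : MemLp g (ENNReal.ofReal p₂) volume) :
    eLpNorm (nnConv f g) (ENNReal.ofReal p) volume ≤
      K * eLpNorm f (ENNReal.ofReal p₁) volume * eLpNorm g (ENNReal.ofReal p₂) volume := by
  have hp0 : 0 < p := by linarith
  obtain ⟨F, hF, hFt, hFf, hFn⟩ := exists_measurable_rpow_rep hp₁ hf0 hf
  obtain ⟨G, hG, hGt, hGg, hGn⟩ := exists_measurable_rpow_rep hp₂ hg0 hg
  rw [eLpNorm_nnConv_eq hp0 hFf hGg, hFn, hGn, mul_assoc]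
  have := hY.lintegral_conv_rpow_le (p := p)
    (by rw [sub_nonneg]; exact (div_le_one hp0).2 hp) hp0 (by field_simp; ring) hF hG hFt hGt
  rwa [sub_sub_cancel] at this

theorem le_eLpNorm_nnConv {p₁ p₂ p : ℝ} (hp₁ : 0 < p₁) (hp₂ : 0 < p₂) (hp0 : 0 < p) (hp : p ≤ 1)
    {K : ℝ≥0∞}
    (hY : ReverseYoungBound (EuclideanSpace ℝ (Fin d)) (1 / p₁) (1 / p₂) (1 - 1 / p) K)
    {f g : EuclideanSpace ℝ (Fin d) → ℝ} (hf0 : ∀ x, 0 ≤ f x) (hg0 : ∀ x, 0 ≤ g x)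
    (hf : MemLp f (ENNReal.ofReal p₁) volume) (hg : MemLp g (ENNReal.ofReal p₂) volume) :
    K * eLpNorm f (ENNReal.ofReal p₁) volume * eLpNorm g (ENNReal.ofReal p₂) volume ≤
      eLpNorm (nnConv f g) (ENNReal.ofReal p) volume := by
  obtain ⟨F, hF, hFt, hFf, hFn⟩ := exists_measurable_rpow_rep hp₁ hf0 hf
  obtain ⟨G, hG, hGt, hGg, hGn⟩ := exists_measurable_rpow_rep hp₂ hg0 hg
  rw [eLpNorm_nnConv_eq hp0 hFf hGg, hFn, hGn, mul_assoc]
  have := hY.le_lintegral_conv_rpow (p := p)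
    (by rw [sub_nonpos]; exact (one_le_div hp0).2 hp) hp0 (by field_simp; ring) hF hG hFt hGt
  rwa [sub_sub_cancel] at this

end EuclideanSpace

/-! ### Identification of the constant -/

lemma Real.rpow_eq_exp_log {x : ℝ} (hx : 0 < x) (y : ℝ) : x ^ y = Real.exp (Real.log x * y) :=
  Real.rpow_def_of_pos hx y

/-- The logarithm of the sharp constant in Young's inequality on the line. -/
noncomputable def logYoungConst (α β γ : ℝ) : ℝ :=
  ((1 - α) * Real.log (1 - α) - α * Real.log α + ((1 - β) * Real.log (1 - β) - β * Real.log β) -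
    (γ * Real.log γ - (1 - γ) * Real.log (1 - γ))) / 2

/-- Here 1/r' = 1 - 1/r. As `Real.log` is even, one formula covers r < 1 and r > 1; at r = 1 the
term 0 · log 0 = 0 reproduces C₁ = 1. -/
lemma youngConst_eq_exp {r : ℝ} (hr : 0 < r) :
    youngConst r = Real.exp (((1 - 1 / r) * Real.log (1 - 1 / r) -
      1 / r * Real.log (1 / r)) / 2) := by
  unfold youngConst
  split_ifs with h
  · simp [h]
  have h1 : r - 1 ≠ 0 := sub_ne_zero.2 h
  have e : 1 - 1 / r = (r / (r - 1))⁻¹ := by field_simp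
  have hpos : 0 < |r / (r - 1)| := abs_pos.2 (div_ne_zero hr.ne' h1)
  rw [e, one_div (r / (r - 1)), Real.rpow_eq_exp_log hr, Real.rpow_eq_exp_log hpos, Real.log_abs,
    ← Real.exp_sub, ← Real.exp_mul, Real.log_inv, one_div r, Real.log_inv]
  congr 1
  ring

lemma youngConst_mul_div_eq_exp {p₁ p₂ p : ℝ} (hp₁ : 0 < p₁) (hp₂ : 0 < p₂) (hp : 0 < p) :
    youngConst p₁ * youngConst p₂ / youngConst p =
      Real.exp (logYoungConst (1 / p₁) (1 / p₂) (1 - 1 / p)) := by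
  rw [youngConst_eq_exp hp₁, youngConst_eq_exp hp₂, youngConst_eq_exp hp, ← Real.exp_add,
    ← Real.exp_sub, logYoungConst, sub_sub_cancel]
  congr 1
  ring

lemma logYoungConst_one {β γ : ℝ} (h : β + γ = 1) : logYoungConst 1 β γ = 0 := by
  obtain rfl : β = 1 - γ := by linarith
  simp [logYoungConst]

lemma logYoungConst_symm (α β γ : ℝ) : logYoungConst α β γ = logYoungConst β α γ := by
  unfold logYoungConst; ring

/-- The powers of π cancel because α + β + γ = 2. Positivity of the quotients, rather than of
numerators and denominators, covers both signs of γ. -/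
lemma trilinearConst_eq_exp {α β γ : ℝ} (hα : 0 < α) (hβ : 0 < β) (hγ1 : γ < 1)
    (hα1 : 0 < (1 - α) / γ) (hβ1 : 0 < (1 - β) / γ) (hγ : γ ≠ 0) (hsum : α + β + γ = 2) :
    trilinearConst α β γ = Real.exp (logYoungConst α β γ) := by
  have e1 : 1 - (1 - α) / γ = (1 - β) / γ := by field_simp; linarith
  have hα0 : 1 - α ≠ 0 := fun h => by simp [h] at hα1
  have hβ0 : 1 - β ≠ 0 := fun h => by simp [h] at hβ1
  have hγ2 : 0 < 1 - γ := by linarith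
  rw [trilinearConst, e1]
  rw [Real.rpow_eq_exp_log (x := Real.pi * ((1 - α) / γ * α)) (by positivity),
    Real.rpow_eq_exp_log (x := Real.pi * ((1 - β) / γ * β)) (by positivity),
    Real.rpow_eq_exp_log (x := Real.pi * ((1 - α) / γ * ((1 - β) / γ))) (by positivity),
    Real.rpow_eq_exp_log (x := Real.pi * (1 - γ)) (by positivity), ← Real.exp_mul,
    ← Real.exp_add, ← Real.exp_add, ← Real.exp_add,
    Real.log_mul Real.pi_ne_zero (by positivity), Real.log_mul Real.pi_ne_zero (by positivity),
    Real.log_mul Real.pi_ne_zero (by positivity), Real.log_mul Real.pi_ne_zero (by positivity),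
    Real.log_mul hα1.ne' hα.ne', Real.log_mul hβ1.ne' hβ.ne', Real.log_mul hα1.ne' hβ1.ne',
    Real.log_div hα0 hγ, Real.log_div hβ0 hγ, logYoungConst]
  obtain rfl : γ = 2 - α - β := by linarith
  congr 1
  ring

/-! ### Gaussian test functions and sharpness -/

section Gaussian

variable {d : ℕ}

lemma lintegral_exp_neg_mul_sq_norm {a : ℝ} (ha : 0 < a) :
    ∫⁻ x : EuclideanSpace ℝ (Fin d), ENNReal.ofReal (Real.exp (-a * ‖x‖ ^ 2)) =
      ENNReal.ofReal (Real.exp (d / 2 * (Real.log Real.pi - Real.log a))) := by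
  have h := GaussianFourier.integral_rexp_neg_mul_sq_norm (V := EuclideanSpace ℝ (Fin d)) ha
  rw [finrank_euclideanSpace_fin, Real.rpow_eq_exp_log (by positivity),
    Real.log_div Real.pi_ne_zero ha.ne', mul_comm] at h
  rw [← h, ofReal_integral_eq_lintegral_ofReal
    (Integrable.of_integral_ne_zero (by rw [h]; positivity))
    (ae_of_all _ fun x => (Real.exp_pos _).le)]

lemma lintegral_gaussian_rpow {a q : ℝ} (ha : 0 < a) (hq : 0 < q) (s : ℝ) :
    (∫⁻ x : EuclideanSpace ℝ (Fin d),
      ENNReal.ofReal (Real.exp (s + -a * ‖x‖ ^ 2)) ^ q) ^ (1 / q) =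
    ENNReal.ofReal (Real.exp (s + d * (1 / q / 2 *
      (Real.log Real.pi - Real.log a - Real.log q)))) := by
  have e : ∀ x : EuclideanSpace ℝ (Fin d), ENNReal.ofReal (Real.exp (s + -a * ‖x‖ ^ 2)) ^ q =
      ENNReal.ofReal (Real.exp (s * q)) * ENNReal.ofReal (Real.exp (-(a * q) * ‖x‖ ^ 2)) := by
    intro x
    rw [ENNReal.ofReal_rpow_of_pos (Real.exp_pos _), ← ENNReal.ofReal_mul (Real.exp_pos _).le,
      ← Real.exp_mul, ← Real.exp_add]
    ring_nf
  simp_rw [e]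
  rw [lintegral_const_mul' _ _ ENNReal.ofReal_ne_top, lintegral_exp_neg_mul_sq_norm (by positivity),
    ← ENNReal.ofReal_mul (Real.exp_pos _).le, ← Real.exp_add,
    ENNReal.ofReal_rpow_of_pos (Real.exp_pos _), ← Real.exp_mul, Real.log_mul ha.ne' hq.ne']
  congr 2
  field_simp
  ring

lemma eLpNorm_gaussian {a q : ℝ} (ha : 0 < a) (hq : 0 < q) :
    eLpNorm (fun x : EuclideanSpace ℝ (Fin d) => Real.exp (-a * ‖x‖ ^ 2)) (ENNReal.ofReal q)
      volume = ENNReal.ofReal (Real.exp (d * (1 / q / 2 *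
        (Real.log Real.pi - Real.log a - Real.log q)))) := by
  rw [eLpNorm_eq_lintegral_rpow_enorm_toReal (by simpa using hq) ENNReal.ofReal_ne_top,
    ENNReal.toReal_ofReal hq.le]
  have := lintegral_gaussian_rpow (d := d) ha hq 0
  simp only [zero_add] at this
  rw [← this]
  congr 1
  refine lintegral_congr fun x => ?_
  rw [Real.enorm_of_nonneg (Real.exp_pos _).le]

lemma memLp_gaussian {a q : ℝ} (ha : 0 < a) (hq : 0 < q) :
    MemLp (fun x : EuclideanSpace ℝ (Fin d) => Real.exp (-a * ‖x‖ ^ 2)) (ENNReal.ofReal q)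
      volume :=
  ⟨by fun_prop, by rw [eLpNorm_gaussian ha hq]; exact ENNReal.ofReal_lt_top⟩

lemma nnConv_gaussian {a b : ℝ} (ha : 0 < a) (hb : 0 < b) (x : EuclideanSpace ℝ (Fin d)) :
    nnConv (fun x => Real.exp (-a * ‖x‖ ^ 2)) (fun x => Real.exp (-b * ‖x‖ ^ 2)) x =
      ENNReal.ofReal (Real.exp (d / 2 * (Real.log Real.pi - Real.log (a + b)) +
        -(a * b / (a + b)) * ‖x‖ ^ 2)) := by
  have hab : 0 < a + b := by positivity
  -- Completing the square in y; the centre is bx/(a+b).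
  have e : ∀ y : EuclideanSpace ℝ (Fin d),
      ENNReal.ofReal (Real.exp (-a * ‖y‖ ^ 2)) * ENNReal.ofReal (Real.exp (-b * ‖x - y‖ ^ 2)) =
      ENNReal.ofReal (Real.exp (-(a * b / (a + b)) * ‖x‖ ^ 2)) *
        ENNReal.ofReal (Real.exp (-(a + b) * ‖y - (b / (a + b)) • x‖ ^ 2)) := by
    intro y
    rw [← ENNReal.ofReal_mul (Real.exp_pos _).le, ← ENNReal.ofReal_mul (Real.exp_pos _).le,
      ← Real.exp_add, ← Real.exp_add, norm_sub_sq_real, norm_sub_sq_real, norm_smul,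
      real_inner_smul_right, real_inner_comm x y, mul_pow, Real.norm_eq_abs, sq_abs]
    congr 2
    field_simp
    ring
  unfold nnConv
  simp_rw [e]
  rw [lintegral_const_mul' _ _ ENNReal.ofReal_ne_top, lintegral_sub_right_eq_self
    (fun y : EuclideanSpace ℝ (Fin d) => ENNReal.ofReal (Real.exp (-(a + b) * ‖y‖ ^ 2))),
    lintegral_exp_neg_mul_sq_norm hab, ← ENNReal.ofReal_mul (Real.exp_pos _).le, ← Real.exp_add,
    add_comm]

/-- The logarithm, per dimension, of the ratio of both sides of Young's inequality for centred
Gaussians. -/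
noncomputable def logGaussianRatio (α β γ a b : ℝ) : ℝ :=
  (-Real.log (a + b) + (1 - γ) * (Real.log (a + b) - Real.log a - Real.log b + Real.log (1 - γ)) +
    α * (Real.log a - Real.log α) + β * (Real.log b - Real.log β)) / 2

lemma eLpNorm_nnConv_gaussian {p₁ p₂ p a b : ℝ} (hp₁ : 0 < p₁) (hp₂ : 0 < p₂) (hp : 0 < p)
    (hscale : 1 / p₁ + 1 / p₂ = 1 + 1 / p) (ha : 0 < a) (hb : 0 < b) :
    eLpNorm (nnConv (d := d) (fun x => Real.exp (-a * ‖x‖ ^ 2)) (fun x => Real.exp (-b * ‖x‖ ^ 2)))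
      (ENNReal.ofReal p) volume =
    ENNReal.ofReal (Real.exp (logGaussianRatio (1 / p₁) (1 / p₂) (1 - 1 / p) a b) ^ d) *
      eLpNorm (fun x : EuclideanSpace ℝ (Fin d) => Real.exp (-a * ‖x‖ ^ 2))
        (ENNReal.ofReal p₁) volume *
      eLpNorm (fun x : EuclideanSpace ℝ (Fin d) => Real.exp (-b * ‖x‖ ^ 2))
        (ENNReal.ofReal p₂) volume := by
  rw [eLpNorm_gaussian ha hp₁, eLpNorm_gaussian hb hp₂,
    eLpNorm_eq_lintegral_rpow_enorm_toReal (by simpa using hp) ENNReal.ofReal_ne_top,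
    ENNReal.toReal_ofReal hp.le]
  simp_rw [enorm_eq_self, nnConv_gaussian ha hb]
  rw [lintegral_gaussian_rpow (by positivity) hp, ← Real.exp_nat_mul,
    ← ENNReal.ofReal_mul (Real.exp_pos _).le, ← ENNReal.ofReal_mul (by positivity),
    ← Real.exp_add, ← Real.exp_add, logGaussianRatio, Real.log_div (by positivity) (by positivity),
    Real.log_mul ha.ne' hb.ne', sub_sub_cancel, one_div p₁, one_div p₂, one_div p, Real.log_inv,
    Real.log_inv, Real.log_inv]
  have : p⁻¹ = p₁⁻¹ + p₂⁻¹ - 1 := by simp only [one_div] at hscale; linarith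
  rw [this]
  congr 2
  ring

lemma logGaussianRatio_symm (α β γ a b : ℝ) :
    logGaussianRatio α β γ a b = logGaussianRatio β α γ b a := by
  unfold logGaussianRatio; rw [add_comm a b]; ring

/-- The Gaussians in the transport, raised to the powers α and β, have rates 1/θ = γ/(1-α) and
1/(1-θ) = γ/(1-β). The common factor |γ| is dropped, the ratio being invariant under dilations. -/
lemma logGaussianRatio_optimal {α β γ : ℝ} (hα1 : 1 - α ≠ 0) (hβ1 : 1 - β ≠ 0) (hγ : γ ≠ 0)
    (hαβ : 0 < (1 - α) * (1 - β)) (hsum : α + β + γ = 2) :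
    logGaussianRatio α β γ |1 - α|⁻¹ |1 - β|⁻¹ = logYoungConst α β γ := by
  have e : |1 - α|⁻¹ + |1 - β|⁻¹ = |γ| / (|1 - α| * |1 - β|) := by
    have h1 : |γ| = |1 - α| + |1 - β| := by
      rw [← (abs_add_eq_add_abs_iff _ _).2]
      · congr 1; linarith
      · rcases mul_pos_iff.1 hαβ with h | h
        · exact Or.inl ⟨h.1.le, h.2.le⟩
        · exact Or.inr ⟨h.1.le, h.2.le⟩
    have := abs_ne_zero.2 hα1
    have := abs_ne_zero.2 hβ1
    rw [h1]; field_simp; ring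
  rw [logGaussianRatio, e, Real.log_div (abs_ne_zero.2 hγ)
    (mul_ne_zero (abs_ne_zero.2 hα1) (abs_ne_zero.2 hβ1)),
    Real.log_mul (abs_ne_zero.2 hα1) (abs_ne_zero.2 hβ1), Real.log_inv, Real.log_inv, Real.log_abs,
    Real.log_abs, Real.log_abs, logYoungConst]
  obtain rfl : γ = 2 - α - β := by linarith
  ring

/-- At α = 1 the optimal rate 1/|1-α| becomes infinite, so the first Gaussian is concentrated along
a = n + 1; the log-ratio is -(γ/2)(log(n+2) - log(n+1)). -/
lemma tendsto_logGaussianRatio_one {β γ : ℝ} (h : β + γ = 1) :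
    Tendsto (fun n : ℕ => logGaussianRatio 1 β γ (n + 1) 1) atTop
      (𝓝 (logYoungConst 1 β γ)) := by
  rw [logYoungConst_one h]
  obtain rfl : β = 1 - γ := by linarith
  have h1 := ((tendsto_add_atTop_iff_nat 1).2 Real.tendsto_log_nat_add_one_sub_log).const_mul
    (-(γ / 2))
  rw [mul_zero] at h1
  refine h1.congr fun n => ?_
  simp only [logGaussianRatio, Real.log_one]
  push_cast
  ring

lemma exists_tendsto_logGaussianRatio {α β γ : ℝ} (hsum : α + β + γ = 2)
    (h : α = 1 ∨ β = 1 ∨ 0 < (1 - α) * (1 - β)) :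
    ∃ a b : ℕ → ℝ, (∀ n, 0 < a n) ∧ (∀ n, 0 < b n) ∧
      Tendsto (fun n => logGaussianRatio α β γ (a n) (b n)) atTop (𝓝 (logYoungConst α β γ)) := by
  rcases h with rfl | rfl | h
  · exact ⟨fun n => n + 1, fun _ => 1, fun n => by positivity, fun _ => one_pos,
      tendsto_logGaussianRatio_one (by linarith)⟩
  · refine ⟨fun _ => 1, fun n => n + 1, fun _ => one_pos, fun n => by positivity, ?_⟩
    simp_rw [logGaussianRatio_symm α 1, logYoungConst_symm α 1]
    exact tendsto_logGaussianRatio_one (by linarith)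
  · have hα : 1 - α ≠ 0 := left_ne_zero_of_mul h.ne'
    have hβ : 1 - β ≠ 0 := right_ne_zero_of_mul h.ne'
    have hγ : γ ≠ 0 := by
      rintro rfl
      obtain rfl : β = 2 - α := by linarith
      nlinarith [sq_nonneg (1 - α)]
    refine ⟨fun _ => |1 - α|⁻¹, fun _ => |1 - β|⁻¹, fun _ => by positivity, fun _ => by positivity,
      ?_⟩
    simp_rw [logGaussianRatio_optimal hα hβ hγ h hsum]
    exact tendsto_const_nhds

end Gaussian

/-! ### Assembly -/

lemma tendsto_ofReal_exp_pow {u : ℕ → ℝ} {l : ℝ} (h : Tendsto u atTop (𝓝 l)) (d : ℕ) :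
    Tendsto (fun n => ENNReal.ofReal (Real.exp (u n) ^ d)) atTop
      (𝓝 (ENNReal.ofReal (Real.exp l ^ d))) :=
  ENNReal.tendsto_ofReal (((Real.continuous_exp.tendsto l).comp h).pow d)

lemma mul_eLpNorm_gaussian_le_iff {d : ℕ} {p₁ p₂ a b : ℝ} (hp₁ : 0 < p₁) (hp₂ : 0 < p₂)
    (ha : 0 < a) (hb : 0 < b) {K K' : ℝ≥0∞} :
    K * eLpNorm (fun x : EuclideanSpace ℝ (Fin d) => Real.exp (-a * ‖x‖ ^ 2))
        (ENNReal.ofReal p₁) volume *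
      eLpNorm (fun x : EuclideanSpace ℝ (Fin d) => Real.exp (-b * ‖x‖ ^ 2))
        (ENNReal.ofReal p₂) volume ≤
    K' * eLpNorm (fun x : EuclideanSpace ℝ (Fin d) => Real.exp (-a * ‖x‖ ^ 2))
        (ENNReal.ofReal p₁) volume *
      eLpNorm (fun x : EuclideanSpace ℝ (Fin d) => Real.exp (-b * ‖x‖ ^ 2))
        (ENNReal.ofReal p₂) volume ↔ K ≤ K' := by
  rw [eLpNorm_gaussian ha hp₁, eLpNorm_gaussian hb hp₂]
  rw [ENNReal.mul_le_mul_iff_left (by simpa using Real.exp_pos _) ENNReal.ofReal_ne_top,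
    ENNReal.mul_le_mul_iff_left (by simpa using Real.exp_pos _) ENNReal.ofReal_ne_top]

lemma youngBound_euclideanSpace_sharp (d : ℕ) {α β γ : ℝ} (hα : 0 < α) (hβ : 0 < β)
    (hα1 : α ≤ 1) (hβ1 : β ≤ 1) (hγ1 : γ < 1) (hsum : α + β + γ = 2) :
    YoungBound (EuclideanSpace ℝ (Fin d)) α β γ
      (ENNReal.ofReal (Real.exp (logYoungConst α β γ) ^ d)) := by
  -- Exponents equal to 1 are split off: there θ degenerates to 0 or 1, or γ = 0, and the constant
  -- is 1.
  rcases hα1.eq_or_lt with rfl | hα1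
  · rw [logYoungConst_one (by linarith)]
    simpa using youngBound_one (E := EuclideanSpace ℝ (Fin d)) hβ.le (by linarith : 0 ≤ γ)
      (by linarith)
  rcases hβ1.eq_or_lt with rfl | hβ1
  · rw [logYoungConst_symm, logYoungConst_one (by linarith)]
    simpa using (youngBound_one (E := EuclideanSpace ℝ (Fin d)) hα.le (by linarith : 0 ≤ γ)
      (by linarith)).symm
  have hγ : 0 < γ := by linarith
  rw [← trilinearConst_eq_exp hα hβ hγ1 (div_pos (by linarith) hγ) (div_pos (by linarith) hγ)
    hγ.ne' hsum, ENNReal.ofReal_pow]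
  · exact (youngBound_real hα hα1 hβ hβ1 hγ hγ1 hsum).euclideanSpace ENNReal.ofReal_ne_top d
  · rw [trilinearConst_eq_exp hα hβ hγ1 (div_pos (by linarith) hγ) (div_pos (by linarith) hγ)
      hγ.ne' hsum]
    positivity

lemma reverseYoungBound_euclideanSpace_sharp (d : ℕ) {α β γ : ℝ}
    (hα1 : 1 ≤ α) (hβ1 : 1 ≤ β) (hsum : α + β + γ = 2) :
    ReverseYoungBound (EuclideanSpace ℝ (Fin d)) α β γ
      (ENNReal.ofReal (Real.exp (logYoungConst α β γ) ^ d)) := by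
  rcases hα1.eq_or_lt with rfl | hα1
  · rw [logYoungConst_one (by linarith)]
    simpa using reverseYoungBound_one (E := EuclideanSpace ℝ (Fin d)) (by linarith : γ ≤ 0)
      (by linarith)
  rcases hβ1.eq_or_lt with rfl | hβ1
  · rw [logYoungConst_symm, logYoungConst_one (by linarith)]
    simpa using (reverseYoungBound_one (E := EuclideanSpace ℝ (Fin d)) (by linarith : γ ≤ 0)
      (by linarith)).symm
  have hγ : γ < 0 := by linarith
  have hc := trilinearConst_eq_exp (by linarith : 0 < α) (by linarith : 0 < β)
    (by linarith : γ < 1) (div_pos_of_neg_of_neg (by linarith) hγ)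
    (div_pos_of_neg_of_neg (by linarith) hγ) hγ.ne hsum
  rw [← hc, ENNReal.ofReal_pow (by rw [hc]; positivity)]
  exact (reverseYoungBound_real hα1 hβ1 hγ hsum).euclideanSpace ENNReal.ofReal_ne_top d

theorem mainTheorem3 (d : ℕ) (hd : 0 < d) (p₁ p₂ p : ℝ) (hp₁ : 0 < p₁) (hp₂ : 0 < p₂)
    (hp : 0 < p) (hscale : 1 / p₁ + 1 / p₂ = 1 + 1 / p) :
    -- the sharp Young inequality, together with the optimality of its constant
    (1 ≤ p₁ → 1 ≤ p₂ →
      (∀ f₁ f₂ : EuclideanSpace ℝ (Fin d) → ℝ, (∀ x, 0 ≤ f₁ x) → (∀ x, 0 ≤ f₂ x) →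
        MemLp f₁ (ENNReal.ofReal p₁) volume → MemLp f₂ (ENNReal.ofReal p₂) volume →
        eLpNorm (nnConv f₁ f₂) (ENNReal.ofReal p) volume ≤
          ENNReal.ofReal ((youngConst p₁ * youngConst p₂ / youngConst p) ^ d) *
            eLpNorm f₁ (ENNReal.ofReal p₁) volume * eLpNorm f₂ (ENNReal.ofReal p₂) volume) ∧
      (∀ K : ℝ≥0∞,
        (∀ f₁ f₂ : EuclideanSpace ℝ (Fin d) → ℝ, (∀ x, 0 ≤ f₁ x) → (∀ x, 0 ≤ f₂ x) →
          MemLp f₁ (ENNReal.ofReal p₁) volume → MemLp f₂ (ENNReal.ofReal p₂) volume →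
          eLpNorm (nnConv f₁ f₂) (ENNReal.ofReal p) volume ≤
            K * eLpNorm f₁ (ENNReal.ofReal p₁) volume *
              eLpNorm f₂ (ENNReal.ofReal p₂) volume) →
        ENNReal.ofReal ((youngConst p₁ * youngConst p₂ / youngConst p) ^ d) ≤ K)) ∧
    -- the sharp reverse Young inequality, together with the optimality of its constant
    (p₁ ≤ 1 → p₂ ≤ 1 →
      (∀ f₁ f₂ : EuclideanSpace ℝ (Fin d) → ℝ, (∀ x, 0 ≤ f₁ x) → (∀ x, 0 ≤ f₂ x) →
        MemLp f₁ (ENNReal.ofReal p₁) volume → MemLp f₂ (ENNReal.ofReal p₂) volume →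
        ENNReal.ofReal ((youngConst p₁ * youngConst p₂ / youngConst p) ^ d) *
            eLpNorm f₁ (ENNReal.ofReal p₁) volume * eLpNorm f₂ (ENNReal.ofReal p₂) volume ≤
          eLpNorm (nnConv f₁ f₂) (ENNReal.ofReal p) volume) ∧
      (∀ K : ℝ≥0∞,
        (∀ f₁ f₂ : EuclideanSpace ℝ (Fin d) → ℝ, (∀ x, 0 ≤ f₁ x) → (∀ x, 0 ≤ f₂ x) →
          MemLp f₁ (ENNReal.ofReal p₁) volume → MemLp f₂ (ENNReal.ofReal p₂) volume →
          K * eLpNorm f₁ (ENNReal.ofReal p₁) volume *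
              eLpNorm f₂ (ENNReal.ofReal p₂) volume ≤
            eLpNorm (nnConv f₁ f₂) (ENNReal.ofReal p) volume) →
        K ≤ ENNReal.ofReal ((youngConst p₁ * youngConst p₂ / youngConst p) ^ d))) := by
  rw [youngConst_mul_div_eq_exp hp₁ hp₂ hp]
  have hsum : 1 / p₁ + 1 / p₂ + (1 - 1 / p) = 2 := by linarith
  have hα : 0 < 1 / p₁ := by positivity
  have hβ : 0 < 1 / p₂ := by positivity
  have hγ : 0 < 1 / p := by positivity
  constructor
  · intro h₁ h₂
    have hα1 : 1 / p₁ ≤ 1 := (div_le_one hp₁).2 h₁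
    have hβ1 : 1 / p₂ ≤ 1 := (div_le_one hp₂).2 h₂
    have hp1 : 1 ≤ p := (div_le_one hp).1 (by linarith)
    constructor
    · intro f₁ f₂ hf₁ hf₂ hm₁ hm₂
      exact eLpNorm_nnConv_le hp₁ hp₂ hp1
        (youngBound_euclideanSpace_sharp d hα hβ hα1 hβ1 (by linarith) hsum) hf₁ hf₂ hm₁ hm₂
    · intro K hK
      obtain ⟨a, b, ha, hb, hab⟩ := exists_tendsto_logGaussianRatio hsum (by
        rcases hα1.eq_or_lt with h | h
        · exact Or.inl h
        rcases hβ1.eq_or_lt with h' | h'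
        · exact Or.inr (Or.inl h')
        exact Or.inr (Or.inr (mul_pos (by linarith) (by linarith))))
      -- Each Gaussian pair forces K to be at least its own ratio, and these ratios converge to the
      -- claimed constant.
      refine le_of_tendsto' (tendsto_ofReal_exp_pow hab d) fun n => ?_
      have := hK _ _ (fun x => (Real.exp_pos _).le) (fun x => (Real.exp_pos _).le)
        (memLp_gaussian (ha n) hp₁) (memLp_gaussian (hb n) hp₂)
      rw [eLpNorm_nnConv_gaussian hp₁ hp₂ hp hscale (ha n) (hb n)] at this
      exact (mul_eLpNorm_gaussian_le_iff hp₁ hp₂ (ha n) (hb n)).1 this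
  · intro h₁ h₂
    have hα1 : 1 ≤ 1 / p₁ := (one_le_div hp₁).2 h₁
    have hβ1 : 1 ≤ 1 / p₂ := (one_le_div hp₂).2 h₂
    have hp1 : p ≤ 1 := (one_le_div hp).1 (by linarith)
    constructor
    · intro f₁ f₂ hf₁ hf₂ hm₁ hm₂
      exact le_eLpNorm_nnConv hp₁ hp₂ hp hp1
        (reverseYoungBound_euclideanSpace_sharp d hα1 hβ1 hsum) hf₁ hf₂ hm₁ hm₂
    · intro K hK
      obtain ⟨a, b, ha, hb, hab⟩ := exists_tendsto_logGaussianRatio hsum (by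
        rcases hα1.eq_or_lt with h | h
        · exact Or.inl h.symm
        rcases hβ1.eq_or_lt with h' | h'
        · exact Or.inr (Or.inl h'.symm)
        exact Or.inr (Or.inr (mul_pos_of_neg_of_neg (by linarith) (by linarith))))
      refine ge_of_tendsto' (tendsto_ofReal_exp_pow hab d) fun n => ?_
      have := hK _ _ (fun x => (Real.exp_pos _).le) (fun x => (Real.exp_pos _).le)
        (memLp_gaussian (ha n) hp₁) (memLp_gaussian (hb n) hp₂)
      rw [eLpNorm_nnConv_gaussian hp₁ hp₂ hp hscale (ha n) (hb n)] at this
      exact (mul_eLpNorm_gaussian_le_iff hp₁ hp₂ (ha n) (hb n)).1 this
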